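/- Let $G=(V,E)$ be a connected locally finite (simple) graph, finite or infinite. Its ends are the equivalence classes of rays (one-way infinite paths), where two rays are equivalent if for every finite $S\subset V$ both have a tail in the same component of $G-S$. Let $|G|$ be the space consisting of $G$, viewed as a 1-complex, together with its ends, in which a set $U$ is open if $U\cap G$ is open in the 1-complex $G$ and for every end $\omega\in U$ there is a finite $S\subset V$ such that $U$ contains the component $C(S,\omega)$ of $G-S$ in which the rays of $\omega$ have tails, all ends with a ray in $C(S,\omega)$, and a half-edge $(z,y]$ of every edge $xy$ with $x\in S$, $y\in C(S,\omega)$ (so $|G|$ is the Freudenthal compactification of $G$). An arc is a homeomorphic image of $[0,1]$ in $|G|$, or a single point; a circle is a homeomorphic image of the unit circle in $|G|$; a circuit is the set $\{e\in E : e\subseteq C\}$ of the edges contained in some circle $C$. A family $(D_i)_{i\in I}$ of subsets of $E$ is thin if no edge lies in $D_i$ for infinitely many $i$; its sum is the set of all edges that lie in $D_i$ for an odd number of indices $i$. The topological cycle space $\mathcal C(G)$ is the set of all sums of thin families of circuits. Let $\ell:E\to(0,\infty)$ be an assignment of edge lengths. Regard every edge $e$ as a real interval of length $\ell(e)$, let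 the length of an arc $A$ be $\ell(A)=\sum_{e\in E}\ell(e\cap A)\in[0,\infty]$, and let $d_\ell(x,y)$ be the infimum of the lengths of all $x$–$y$ arcs in $|G|$. Suppose that $(|G|,\ell)$ is a metric representation of $G$, i.e. that $d_\ell$ is a (finite) metric on $|G|$ which induces the topology of $|G|$. Call a circle $C$ $\ell$-geodetic if for every two points $x,y\in C$ one of the two $x$–$y$ arcs in $C$ has length $d_\ell(x,y)$, and call the circuit of an $\ell$-geodetic circle an $\ell$-geodetic circuit. Then $\mathcal C(G)$ is generated by the $\ell$-geodetic circles: $\mathcal C(G)$ is exactly the set of all sums of thin families of $\ell$-geodetic circuits. In particular, every element of $\mathcal C(G)$ is the sum of a thin family of $\ell$-geodetic circuits. -/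

import Mathlib

open Set Topology MeasureTheory
open scoped ENNReal NNReal unitInterval

universe u w

noncomputable section

namespace EndGraph

variable {V : Type u}

/-! ### Rays and ends -/

/-- A ray: a one-way infinite path in `G`. -/
structure Ray (G : SimpleGraph V) where
  /-- the sequence of vertices of the ray -/
  vert : ℕ → V
  inj : Function.Injective vert
  adj : ∀ n, G.Adj (vert n) (vert (n + 1))

/-- `a` and `b` lie in the same component of `G - S` (in particular both are outside `S`). -/
def JoinedOff (G : SimpleGraph V) (S : Finset V) (a b : V) : Prop :=
  ∃ p : G.Walk a b, ∀ x ∈ p.support, x ∉ S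

theorem JoinedOff.symm {G : SimpleGraph V} {S : Finset V} {a b : V}
    (h : JoinedOff G S a b) : JoinedOff G S b a := by
  obtain ⟨p, hp⟩ := h
  exact ⟨p.reverse, by simpa using hp⟩

theorem JoinedOff.trans {G : SimpleGraph V} {S : Finset V} {a b c : V}
    (h : JoinedOff G S a b) (h' : JoinedOff G S b c) : JoinedOff G S a c := by
  obtain ⟨p, hp⟩ := h
  obtain ⟨q, hq⟩ := h'
  refine ⟨p.append q, fun x hx => ?_⟩
  rw [SimpleGraph.Walk.mem_support_append_iff] at hx
  exact hx.elim (hp x) (hq x)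

theorem JoinedOff.mono {G : SimpleGraph V} {S T : Finset V} (hST : S ⊆ T) {a b : V}
    (h : JoinedOff G T a b) : JoinedOff G S a b := by
  obtain ⟨p, hp⟩ := h
  exact ⟨p, fun x hx hxS => hp x hx (hST hxS)⟩

theorem Ray.joinedOff_tail {G : SimpleGraph V} (R : Ray G) (S : Finset V) :
    ∃ N, ∀ n ≥ N, ∀ m ≥ N, JoinedOff G S (R.vert n) (R.vert m) := by
  have hfin : {n | R.vert n ∈ S}.Finite := S.finite_toSet.preimage R.inj.injOn
  obtain ⟨N, hN⟩ := hfin.bddAbove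
  have hout : ∀ n ≥ N + 1, R.vert n ∉ S := fun n hn h => by
    have : n ≤ N := hN h
    omega
  have key : ∀ n ≥ N + 1, JoinedOff G S (R.vert (N + 1)) (R.vert n) := by
    intro n hn
    induction n, hn using Nat.le_induction with
    | base => exact ⟨SimpleGraph.Walk.nil, by simpa using hout _ le_rfl⟩
    | succ n hn ih =>
      refine ih.trans ⟨SimpleGraph.Walk.cons (R.adj n) SimpleGraph.Walk.nil, ?_⟩
      intro x hx
      simp only [SimpleGraph.Walk.support_cons, SimpleGraph.Walk.support_nil, List.mem_cons,
        List.not_mem_nil, or_false] at hx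
      rcases hx with rfl | rfl
      · exact hout n hn
      · exact hout _ (by omega)
  exact ⟨N + 1, fun n hn m hm => (key n hn).symm.trans (key m hm)⟩

/-- Two rays are equivalent if no finite set of vertices separates them: for every finite `S`,
both have a tail in the same component of `G - S`. -/
def Ray.setoid (G : SimpleGraph V) : Setoid (Ray G) where
  r R L := ∀ S : Finset V, ∃ N, ∀ n ≥ N, ∀ m ≥ N, JoinedOff G S (R.vert n) (L.vert m)
  iseqv :=
    { refl := fun R S => R.joinedOff_tail S
      symm := fun h S => by
        obtain ⟨N, hN⟩ := h S
        exact ⟨N, fun n hn m hm => (hN m hm n hn).symm⟩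
      trans := fun h h' S => by
        obtain ⟨N, hN⟩ := h S
        obtain ⟨M, hM⟩ := h' S
        refine ⟨max N M, fun n hn m hm => ?_⟩
        exact (hN n (le_trans (le_max_left _ _) hn) (max N M) (le_max_left _ _)).trans
          (hM (max N M) (le_max_right _ _) m (le_trans (le_max_right _ _) hm)) }

/-- An end of `G`: an equivalence class of rays. -/
def GraphEnd (G : SimpleGraph V) : Type u := Quotient (Ray.setoid G)

/-- The end to which a ray belongs. -/
def Ray.toEnd {G : SimpleGraph V} (R : Ray G) : GraphEnd G := Quotient.mk (Ray.setoid G) R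

/-- `C(S, ω)`: the vertex set of the component of `G - S` that contains a tail of some
(equivalently, of every) ray of `ω`. -/
def endComponent (G : SimpleGraph V) (S : Finset V) (ω : GraphEnd G) : Set V :=
  {v | ∃ R : Ray G, R.toEnd = ω ∧ ∃ N, ∀ n ≥ N, JoinedOff G S v (R.vert n)}

/-! ### The space `|G|` -/

open Classical in
/-- The points of the 1-complex `G`, in barycentric coordinates: the vertices are the unit
vectors of `ℝ ^ V` and the edge `uv` is the segment between the unit vectors of `u` and `v`. -/
@[ext]
structure OneComplex (G : SimpleGraph V) : Type u where
  /-- the barycentric coordinates of the point -/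
  coord : V → ℝ
  mem : (∃ v, coord = Pi.single v 1) ∨
    ∃ u v, G.Adj u v ∧ coord ∈ segment ℝ (Pi.single u (1 : ℝ)) (Pi.single v (1 : ℝ))

/-- The point set of `|G|`: the points of the 1-complex `G`, and the ends of `G`. -/
inductive Space (G : SimpleGraph V) : Type u
  | inG (x : OneComplex G) : Space G
  | atEnd (ω : GraphEnd G) : Space G

open Classical in
/-- The point `(1 - t) u + t v` of the edge `uv`. -/
def edgePoint {G : SimpleGraph V} {u v : V} (h : G.Adj u v) (t : I) : Space G :=
  .inG ⟨(1 - (t : ℝ)) • Pi.single u (1 : ℝ) + (t : ℝ) • Pi.single v (1 : ℝ),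
    Or.inr ⟨u, v, h, 1 - (t : ℝ), t, by linarith [t.2.2], t.2.1, by ring, rfl⟩⟩

/-- The points of `C(S, ω)`, viewed as a subgraph of the 1-complex (its vertices and the edges
between them), together with all ends that have a ray in `C(S, ω)`. -/
def endRegion (G : SimpleGraph V) (S : Finset V) (ω : GraphEnd G) : Set (Space G) :=
  {x | match x with
    | .inG p => ∀ v, p.coord v ≠ 0 → v ∈ endComponent G S ω
    | .atEnd η => ∃ R : Ray G, R.toEnd = η ∧ ∀ n, R.vert n ∈ endComponent G S ω}

theorem endComponent_mono (G : SimpleGraph V) {S T : Finset V} (hST : S ⊆ T) (ω : GraphEnd G) :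
    endComponent G T ω ⊆ endComponent G S ω := by
  rintro v ⟨R, hR, N, hN⟩
  exact ⟨R, hR, N, fun n hn => (hN n hn).mono hST⟩

theorem endRegion_mono (G : SimpleGraph V) {S T : Finset V} (hST : S ⊆ T) (ω : GraphEnd G) :
    endRegion G T ω ⊆ endRegion G S ω := by
  rintro (p | η) hx
  · exact fun v hv => endComponent_mono G hST ω (hx v hv)
  · obtain ⟨R, hR, hn⟩ := hx
    exact ⟨R, hR, fun n => endComponent_mono G hST ω (hn n)⟩

/-- The topology of `|G|`. A set `U` is open if its trace on every edge is open (so that `U` meets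
`G` in an open set of the 1-complex) and if for every end `ω` in `U` there is a finite set `S` of
vertices such that `U` contains `C(S, ω)` and all ends with a ray in `C(S, ω)`. Such a `U` also
contains, for every edge `xy` with `x ∈ S` and `y ∈ C(S, ω)`, some half-edge `(z, y]`, because `y`
lies in `U` and the trace of `U` on `xy` is open; so the open sets are the unions of open sets of
the 1-complex and of basic open neighbourhoods
`C(S, ω) ∪ Ω(S, ω) ∪ E'(S, ω)` of ends. -/
instance Space.instTopologicalSpace (G : SimpleGraph V) : TopologicalSpace (Space G) where
  IsOpen U := (∀ (u v : V) (h : G.Adj u v), IsOpen {t : I | edgePoint h t ∈ U}) ∧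
    ∀ ω : GraphEnd G, Space.atEnd ω ∈ U → ∃ S : Finset V, endRegion G S ω ⊆ U
  isOpen_univ := ⟨fun _ _ _ => by simp, fun _ _ => ⟨∅, subset_univ _⟩⟩
  isOpen_inter := by
    classical
    rintro U W ⟨hU, hU'⟩ ⟨hW, hW'⟩
    refine ⟨fun u v h => (hU u v h).inter (hW u v h), fun ω hω => ?_⟩
    obtain ⟨S, hS⟩ := hU' ω hω.1
    obtain ⟨T, hT⟩ := hW' ω hω.2
    exact ⟨S ∪ T, subset_inter
      ((endRegion_mono G Finset.subset_union_left ω).trans hS)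
      ((endRegion_mono G Finset.subset_union_right ω).trans hT)⟩
  isOpen_sUnion := by
    intro 𝒰 h𝒰
    refine ⟨fun u v h => ?_, fun ω hω => ?_⟩
    · have : {t : I | edgePoint h t ∈ ⋃₀ 𝒰} = ⋃ U ∈ 𝒰, {t : I | edgePoint h t ∈ U} := by
        ext t; simp
      rw [this]
      exact isOpen_biUnion fun U hU => (h𝒰 U hU).1 u v h
    · obtain ⟨U, hU, hωU⟩ := hω
      obtain ⟨S, hS⟩ := (h𝒰 U hU).2 ω hωU
      exact ⟨S, hS.trans (subset_sUnion_of_mem hU)⟩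

/-! ### Arcs, circles and circuits -/

/-- `A` is an arc between `x` and `y`: a homeomorphic image of `[0, 1]` with endpoints `x`, `y`,
or `A = {x}` and `x = y`. -/
def IsArc {X : Type*} [TopologicalSpace X] (x y : X) (A : Set X) : Prop :=
  (∃ γ : I → X, IsEmbedding γ ∧ γ 0 = x ∧ γ 1 = y ∧ range γ = A) ∨ (x = y ∧ A = {x})

/-- A circle: a homeomorphic image of the unit circle. -/
def IsCircle {X : Type*} [TopologicalSpace X] (C : Set X) : Prop :=
  ∃ γ : Circle → X, IsEmbedding γ ∧ range γ = C

/-- The edge `e` as a subset of `|G|`, endvertices included. -/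
def edgePoints {G : SimpleGraph V} (e : G.edgeSet) : Set (Space G) :=
  {x | ∃ (u v : V) (h : G.Adj u v), s(u, v) = (e : Sym2 V) ∧ ∃ t : I, edgePoint h t = x}

/-- The set of edges contained in a subset of `|G|`. -/
def edgesIn {G : SimpleGraph V} (X : Set (Space G)) : Set G.edgeSet := {e | edgePoints e ⊆ X}

/-- The circuits of `G`: the edge sets of the circles in `|G|`. -/
def circuits (G : SimpleGraph V) : Set (Set G.edgeSet) :=
  {D | ∃ C : Set (Space G), IsCircle C ∧ D = edgesIn C}

/-! ### Thin sums and the topological cycle space -/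

/-- A family of sets is thin if no element lies in infinitely many of its members. -/
def IsThin {E : Type*} {ι : Type*} (F : ι → Set E) : Prop := ∀ e, {i | e ∈ F i}.Finite

/-- The sum of a thin family: the elements that lie in an odd number of its members. -/
def thinSum {E : Type*} {ι : Type*} (F : ι → Set E) : Set E := {e | Odd {i | e ∈ F i}.ncard}

/-- The set generated by `𝒟`: all sums of thin families of members of `𝒟`. -/
def thinSums {E : Type u} (𝒟 : Set (Set E)) : Set (Set E) :=
  {D | ∃ (ι : Type w) (F : ι → Set E), (∀ i, F i ∈ 𝒟) ∧ IsThin F ∧ D = thinSum F}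

/-- The topological cycle space of `G`. -/
def cycleSpace (G : SimpleGraph V) : Set (Set G.edgeSet) := thinSums.{u, w} (circuits G)

/-! ### Lengths and metric representations -/

theorem adj_out {G : SimpleGraph V} (e : G.edgeSet) :
    G.Adj (Quot.out (e : Sym2 V)).1 (Quot.out (e : Sym2 V)).2 := by
  have h : s((Quot.out (e : Sym2 V)).1, (Quot.out (e : Sym2 V)).2) = (e : Sym2 V) :=
    Quot.out_eq (e : Sym2 V)
  rw [← SimpleGraph.mem_edgeSet, h]
  exact e.2

/-- The length of `X`, where each edge `e` is a real interval of length `ℓ e`: the sum over all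
edges `e` of the length of `e ∩ X`. For an arc, `e ∩ X` is a union of at most two subintervals of
`e`, and its length is `ℓ e` times the Lebesgue measure of the set of parameters in `[0, 1]` of its
points. The orientation of `e` used to parametrise it is irrelevant. -/
def length {G : SimpleGraph V} (ℓ : G.edgeSet → ℝ≥0) (X : Set (Space G)) : ℝ≥0∞ :=
  ∑' e : G.edgeSet, (ℓ e : ℝ≥0∞) * volume {t : I | edgePoint (adj_out e) t ∈ X}

/-- `d_ℓ(x, y)`: the infimum of the lengths of all arcs between `x` and `y` in `|G|`. -/
def arcDist {G : SimpleGraph V} (ℓ : G.edgeSet → ℝ≥0) (x y : Space G) : ℝ≥0∞ :=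
  ⨅ (A : Set (Space G)) (_ : IsArc x y A), length ℓ A

/-- `(|G|, ℓ)` is a metric representation of `G`: the edge lengths `ℓ` are positive and `d_ℓ` is a
metric on `|G|` (in particular finite) that induces the topology of `|G|`. -/
def IsMetricRepresentation (G : SimpleGraph V) (ℓ : G.edgeSet → ℝ≥0) : Prop :=
  (∀ e, 0 < ℓ e) ∧
  ∃ m : MetricSpace (Space G),
    (∀ x y : Space G, arcDist ℓ x y = ENNReal.ofReal (m.dist x y)) ∧
    m.toUniformSpace.toTopologicalSpace = Space.instTopologicalSpace G

/-- A circle `C` is `ℓ`-geodetic if for any two points `x`, `y` of `C` one of the (two) arcs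
between `x` and `y` in `C` has length `d_ℓ(x, y)`. -/
def IsGeodeticCircle {G : SimpleGraph V} (ℓ : G.edgeSet → ℝ≥0) (C : Set (Space G)) : Prop :=
  IsCircle C ∧ ∀ x ∈ C, ∀ y ∈ C, ∃ A ⊆ C, IsArc x y A ∧ length ℓ A = arcDist ℓ x y

/-- The `ℓ`-geodetic circuits: the edge sets of the `ℓ`-geodetic circles. -/
def geodeticCircuits (G : SimpleGraph V) (ℓ : G.edgeSet → ℝ≥0) : Set (Set G.edgeSet) :=
  {D | ∃ C : Set (Space G), IsGeodeticCircle ℓ C ∧ D = edgesIn C}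

end EndGraph

end

namespace EndGraph

/-! ### The rise of a curve in the circle -/

/-! One inclusion is immediate, since geodetic circuits are circuits. For the other, the finite cuts
serve as an intermediary: every circuit meets every finite cut in an even number of edges
(`CutEven.circle`), thin sums preserve this (`CutEven.thinSum`), and every edge set that is even on
all finite cuts is a thin sum of geodetic circuits (`Represents.mem_thinSums`).

The geometric core is a shortest-loop argument. Collapsing everything outside an edge `e` to a point
maps `|G|` onto a circle (`edgeCoord`). For a finite edge set `F`, the sum `π` of these maps over
`F` assigns to each loop an integer rise, counting modulo 2 how often the loop runs through `F`. By
compactness, among the loops of odd rise there is a shortest one. A shortcut across it would split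
it into two shorter loops, one of them again odd; so it is isometrically embedded, hence a geodetic
circle (`exists_isometric_circle`, `Represents.isGeodeticCircle`). Thus, if `F` meets every geodetic
circuit with edges of length at most `δ` evenly, every loop of length at most `δ` has even rise
(`Represents.even_of_loop`).

Now let the components of `G - S` have diameter less than `ε`, let `F` be even on all short geodetic
circuits (`δ = 4ε`), and let `x` be cut-even and zero at `S`. Parities of short paths from a root in
each component define a vertex set `A` whose cut agrees with `F` away from `S`; this cut is finite,
so `x` sums to zero over `F` (`Represents.sum_eq_zero`). By duality over the field with two
elements, `x` agrees on any given finite edge set with a finite sum of short geodetic circuits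
(`exists_list_of_functionals`).

Iterating over growing balls `S`, outside which the components become arbitrarily small
(`exists_gball_small`), removes the given set edge by edge. The circuits used at late stages have
only short edges, so each edge lies in finitely many of them and the resulting family is thin. -/

theorem exists_circle_lift {f : ℝ → UnitAddCircle} (hf : Continuous f) :
    ∃ g : ℝ → ℝ, Continuous g ∧ ∀ t, (g t : UnitAddCircle) = f t := by
  obtain ⟨e, he⟩ := QuotientAddGroup.mk_surjective (f 0)
  obtain ⟨F, ⟨-, hF⟩, -⟩ := (AddCircle.isCoveringMap_coe (1 : ℝ)).existsUnique_continuousMap_lifts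
    (⟨f, hf⟩ : C(ℝ, UnitAddCircle)) (a₀ := (0 : ℝ)) (e₀ := e) he
  exact ⟨F, F.continuous, fun t => congrFun hF t⟩

theorem coe_eq_coe_iff_int {x y : ℝ} :
    (x : UnitAddCircle) = y ↔ ∃ k : ℤ, x - y = k := by
  rw [← sub_eq_zero, ← AddCircle.coe_sub, AddCircle.coe_eq_zero_iff]
  simp [eq_comm]

open Classical in
/-- The increment over `[s, t]` of a continuous lift of `f` to the real line. -/
noncomputable def rise (f : ℝ → UnitAddCircle) (s t : ℝ) : ℝ :=
  if h : Continuous f then (exists_circle_lift h).choose t - (exists_circle_lift h).choose s else 0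

/-- Two lifts of one curve differ by a continuous integer-valued function, which is constant on an
interval. Hence the increment does not depend on the lift. -/
theorem sub_eq_sub_of_lifts {g g' : ℝ → ℝ} {s t : ℝ} (hg : ContinuousOn g (uIcc s t))
    (hg' : ContinuousOn g' (uIcc s t))
    (h : ∀ x ∈ uIcc s t, (g x : UnitAddCircle) = g' x) : g t - g s = g' t - g' s := by
  have hc : ContinuousOn (fun x => g x - g' x) (uIcc s t) := hg.sub hg'
  have hr : ∀ x ∈ uIcc s t, g x - g' x ∈ range ((↑) : ℤ → ℝ) := fun x hx => by
    obtain ⟨k, hk⟩ := coe_eq_coe_iff_int.1 (h x hx)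
    exact ⟨k, hk.symm⟩
  have hd : IsDiscrete (range ((↑) : ℤ → ℝ)) :=
    Int.isClosedEmbedding_coe_real.isInducing.isDiscrete_range
  have := (isPreconnected_uIcc (a := s) (b := t)).constant_of_mapsTo hd hc hr
    left_mem_uIcc right_mem_uIcc
  linarith

theorem rise_eq {f : ℝ → UnitAddCircle} (hf : Continuous f) {g : ℝ → ℝ} {s t : ℝ}
    (hg : ContinuousOn g (uIcc s t)) (h : ∀ x ∈ uIcc s t, (g x : UnitAddCircle) = f x) :
    rise f s t = g t - g s := by
  rw [rise, dif_pos hf]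
  have := (exists_circle_lift hf).choose_spec
  exact sub_eq_sub_of_lifts this.1.continuousOn hg fun x hx => (this.2 x).trans (h x hx).symm

theorem rise_eq' {f : ℝ → UnitAddCircle} {g : ℝ → ℝ} (hg : Continuous g)
    (h : ∀ x, (g x : UnitAddCircle) = f x) (s t : ℝ) : rise f s t = g t - g s := by
  have hf : Continuous f := by
    have : f = fun x => (g x : UnitAddCircle) := funext fun x => (h x).symm
    rw [this]
    exact (AddCircle.continuous_mk' 1).comp hg
  exact rise_eq hf hg.continuousOn fun x _ => h x

theorem rise_congr {f f' : ℝ → UnitAddCircle} (hf : Continuous f) (hf' : Continuous f') {s t : ℝ}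
    (h : ∀ x ∈ uIcc s t, f x = f' x) : rise f s t = rise f' s t := by
  obtain ⟨g, hg, hgf⟩ := exists_circle_lift hf'
  rw [rise_eq' hg hgf, rise_eq hf hg.continuousOn fun x hx => (hgf x).trans (h x hx).symm]

theorem rise_add_adjacent {f : ℝ → UnitAddCircle} (hf : Continuous f) (r s t : ℝ) :
    rise f r s + rise f s t = rise f r t := by
  obtain ⟨g, hg, hgf⟩ := exists_circle_lift hf
  simp only [rise_eq' hg hgf]
  ring

theorem rise_comp {f : ℝ → UnitAddCircle} (hf : Continuous f) {p : ℝ → ℝ} (hp : Continuous p)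
    (s t : ℝ) : rise (fun x => f (p x)) s t = rise f (p s) (p t) := by
  obtain ⟨g, hg, hgf⟩ := exists_circle_lift hf
  rw [rise_eq' hg hgf, rise_eq' (hg.comp hp) fun x => hgf (p x)]
  rfl

theorem rise_symm {f : ℝ → UnitAddCircle} (hf : Continuous f) (s t : ℝ) :
    rise f t s = - rise f s t := by
  obtain ⟨g, hg, hgf⟩ := exists_circle_lift hf
  simp only [rise_eq' hg hgf]
  ring

theorem rise_add {f f' : ℝ → UnitAddCircle} (hf : Continuous f) (hf' : Continuous f') (s t : ℝ) :
    rise (fun x => f x + f' x) s t = rise f s t + rise f' s t := by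
  obtain ⟨g, hg, hgf⟩ := exists_circle_lift hf
  obtain ⟨g', hg', hgf'⟩ := exists_circle_lift hf'
  rw [rise_eq' hg hgf, rise_eq' hg' hgf', rise_eq' (hg.add hg') fun x => by
    rw [Pi.add_apply, AddCircle.coe_add, hgf, hgf']]
  simp only [Pi.add_apply]
  ring

theorem rise_zsmul {f : ℝ → UnitAddCircle} (hf : Continuous f) (k : ℤ) (s t : ℝ) :
    rise (fun x => k • f x) s t = k * rise f s t := by
  obtain ⟨g, hg, hgf⟩ := exists_circle_lift hf
  rw [rise_eq' hg hgf, rise_eq' (hg.const_smul k) fun x => by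
    rw [Pi.smul_apply, AddCircle.coe_zsmul, hgf]]
  simp only [Pi.smul_apply, zsmul_eq_mul]
  ring

theorem rise_const (x : UnitAddCircle) (s t : ℝ) : rise (fun _ => x) s t = 0 := by
  obtain ⟨e, he⟩ := QuotientAddGroup.mk_surjective x
  rw [rise_eq' (g := fun _ => e) continuous_const fun _ => he, sub_self]

theorem rise_sum {ι : Type*} (F : Finset ι) {f : ι → ℝ → UnitAddCircle}
    (hf : ∀ i, Continuous (f i)) (s t : ℝ) :
    rise (fun x => ∑ i ∈ F, f i x) s t = ∑ i ∈ F, rise (f i) s t := by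
  classical
  induction F using Finset.induction_on with
  | empty => simpa using rise_const 0 s t
  | insert i F hi ih =>
    simp only [Finset.sum_insert hi]
    rw [rise_add (hf i) (continuous_finsetSum _ fun i _ => hf i), ih]

theorem exists_int_rise {f : ℝ → UnitAddCircle} (hf : Continuous f) {s t : ℝ} (h : f s = f t) :
    ∃ k : ℤ, rise f s t = k := by
  obtain ⟨g, hg, hgf⟩ := exists_circle_lift hf
  rw [rise_eq' hg hgf]
  exact coe_eq_coe_iff_int.1 (by rw [hgf, hgf, h])

/-- A curve that stays close to `0` has a small rise. -/
theorem abs_rise_lt {f : ℝ → UnitAddCircle} (hf : Continuous f) {s t : ℝ}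
    (h : ∀ x ∈ uIcc s t, ‖f x‖ < 1 / 4) : |rise f s t| < 1 / 2 := by
  obtain ⟨g, hg, hgf⟩ := exists_circle_lift hf
  have hrd : ∀ x ∈ uIcc s t, |g x - round (g x)| < 1 / 4 := fun x hx => by
    have := h x hx
    rwa [← hgf, UnitAddCircle.norm_eq] at this
  -- If the nearest integers differed, the lift would pass through a half-integer, where the norm in
  -- the circle is `1 / 2`.
  have hc : round (g s) = round (g t) := by
    by_contra hne
    have hdist : ∃ x ∈ uIcc s t, g x = round (g s) + 1 / 2 ∨ g x = round (g s) - 1 / 2 := by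
      have h1 := abs_lt.1 (hrd s left_mem_uIcc)
      have h2 := abs_lt.1 (hrd t right_mem_uIcc)
      have hsub := intermediate_value_uIcc (hg.continuousOn (s := uIcc s t))
      rcases lt_or_gt_of_ne hne with hlt | hlt
      · have : (round (g s) : ℝ) + 1 ≤ round (g t) := by exact_mod_cast hlt
        obtain ⟨x, hx, hxe⟩ := hsub (show (round (g s) + 1 / 2 : ℝ) ∈ uIcc (g s) (g t) by
          rw [mem_uIcc]; left; constructor <;> linarith)
        exact ⟨x, hx, Or.inl hxe⟩
      · have : (round (g t) : ℝ) + 1 ≤ round (g s) := by exact_mod_cast hlt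
        obtain ⟨x, hx, hxe⟩ := hsub (show (round (g s) - 1 / 2 : ℝ) ∈ uIcc (g s) (g t) by
          rw [mem_uIcc]; right; constructor <;> linarith)
        exact ⟨x, hx, Or.inr hxe⟩
    obtain ⟨x, hx, hxe⟩ := hdist
    have hx' := abs_lt.1 (hrd x hx)
    have hr := abs_le.1 (abs_sub_round (g x))
    generalize round (g x) = m at hx' hr
    generalize round (g s) = n at hxe
    have : (2 * (m - n) : ℝ) < 2 ∧ (-2 : ℝ) < 2 * (m - n) := by
      rcases hxe with hxe | hxe <;> constructor <;> linarith
    have h3 : m - n < 1 := by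
      have : ((m - n : ℤ) : ℝ) < 1 := by push_cast; linarith [this.1]
      exact_mod_cast this
    have h4 : -1 < m - n := by
      have : (-1 : ℝ) < ((m - n : ℤ) : ℝ) := by push_cast; linarith [this.2]
      exact_mod_cast this
    have : m = n := by omega
    subst this
    rcases hxe with hxe | hxe <;> linarith [hx'.1, hx'.2]
  have h1 := abs_lt.1 (hrd s left_mem_uIcc)
  have h2 := abs_lt.1 (hrd t right_mem_uIcc)
  rw [rise_eq' hg hgf, abs_lt]
  rw [hc] at h1
  constructor <;> linarith

/-! ### Curves of bounded length in a metric space -/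

section Curves

variable {X : Type*} [MetricSpace X] {π : X → UnitAddCircle}

/-- There is a 1-Lipschitz curve from `x` to `y`, parametrised by `[0, a]`, along which `π` rises
by `k`. -/
def RPath (π : X → UnitAddCircle) (x y : X) (a k : ℝ) : Prop :=
  0 ≤ a ∧ ∃ c : ℝ → X, LipschitzWith 1 c ∧ c 0 = x ∧ c a = y ∧ rise (fun t => π (c t)) 0 a = k

theorem lipschitzWith_one_concat {c c' : ℝ → X} (hc : LipschitzWith 1 c) (hc' : LipschitzWith 1 c')
    {a : ℝ} (h : c a = c' 0) : LipschitzWith 1 (fun t => if t ≤ a then c t else c' (t - a)) := by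
  refine LipschitzWith.of_dist_le_mul fun s t => ?_
  wlog hst : s ≤ t generalizing s t
  · rw [dist_comm, dist_comm s]
    exact this t s (le_of_not_ge hst)
  have h1 := fun x y => by simpa using hc.dist_le_mul x y
  have h2 := fun x y => by simpa using hc'.dist_le_mul x y
  simp only [NNReal.coe_one, one_mul]
  split_ifs with hs ht ht
  · exact h1 _ _
  · refine (dist_triangle _ (c a) _).trans ?_
    have h3 := h1 s a
    have h4 := h2 0 (t - a)
    rw [h]
    rw [h] at h3
    rw [Real.dist_eq, abs_of_nonpos (by linarith)] at h3 ⊢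
    rw [Real.dist_eq, abs_of_nonpos (by linarith)] at h4
    linarith
  · linarith
  · refine (h2 _ _).trans (le_of_eq ?_)
    rw [Real.dist_eq, Real.dist_eq]
    congr 1
    ring

theorem RPath.trans (hπ : Continuous π) {x y z : X} {a b k l : ℝ} (h : RPath π x y a k)
    (h' : RPath π y z b l) : RPath π x z (a + b) (k + l) := by
  obtain ⟨ha, c, hc, rfl, rfl, rfl⟩ := h
  obtain ⟨hb, c', hc', h0, rfl, rfl⟩ := h'
  have hL := lipschitzWith_one_concat hc hc' h0.symm
  refine ⟨by positivity, _, hL, by simp [ha], ?_, ?_⟩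
  · split_ifs with hba
    · have : b = 0 := by linarith
      subst this
      rw [add_zero, h0]
    · rw [add_sub_cancel_left]
  · rw [← rise_add_adjacent (hπ.comp' hL.continuous) 0 a]
    congr 1
    · refine rise_congr (hπ.comp' hL.continuous) (hπ.comp' hc.continuous) fun x hx => ?_
      rw [uIcc_of_le ha] at hx
      simp [hx.2]
    · have := rise_comp (hπ.comp' hc'.continuous) (p := fun x => x - a) (by fun_prop) a (a + b)
      simp only [sub_self, add_sub_cancel_left] at this
      rw [← this]
      refine rise_congr (hπ.comp' hL.continuous) ?_ fun x hx => ?_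
      · exact hπ.comp' (hc'.continuous.comp (by fun_prop))
      · rw [uIcc_of_le (by linarith)] at hx
        split_ifs with hxa
        · have : x = a := le_antisymm hxa hx.1
          subst this
          rw [sub_self, h0]
        · rfl

theorem RPath.symm (hπ : Continuous π) {x y : X} {a k : ℝ} (h : RPath π x y a k) :
    RPath π y x a (-k) := by
  obtain ⟨ha, c, hc, rfl, rfl, rfl⟩ := h
  refine ⟨ha, fun t => c (a - t), ?_, by simp, by simp, ?_⟩
  · refine LipschitzWith.of_dist_le_mul fun s t => ?_
    refine (hc.dist_le_mul _ _).trans (le_of_eq ?_)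
    rw [Real.dist_eq, Real.dist_eq, ← abs_neg]
    congr 2
    ring
  · rw [rise_comp (hπ.comp' hc.continuous) (p := fun t => a - t) (by fun_prop)]
    simp only [sub_zero, sub_self]
    exact rise_symm (hπ.comp' hc.continuous) _ _

theorem rPath_of_lipschitz (hπ : Continuous π) {c : ℝ → X} (hc : LipschitzWith 1 c) {s t : ℝ}
    (hst : s ≤ t) : RPath π (c s) (c t) (t - s) (rise (fun t => π (c t)) s t) := by
  refine ⟨by linarith, fun r => c (s + r), ?_, by simp, by simp, ?_⟩
  · refine LipschitzWith.of_dist_le_mul fun s t => ?_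
    refine (hc.dist_le_mul _ _).trans (le_of_eq ?_)
    rw [dist_add_left]
  · rw [rise_comp (hπ.comp' hc.continuous) (p := fun r => s + r) (by fun_prop)]
    simp

/-- Any two points are joined by 1-Lipschitz curves of almost minimal length. -/
def IsLengthSpace (X : Type*) [MetricSpace X] : Prop :=
  ∀ (x y : X) (r : ℝ), dist x y < r →
    ∃ a < r, 0 ≤ a ∧ ∃ c : ℝ → X, LipschitzWith 1 c ∧ c 0 = x ∧ c a = y

theorem IsLengthSpace.exists_rPath (hX : IsLengthSpace X) (π : X → UnitAddCircle) {x y : X} {r : ℝ}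
    (h : dist x y < r) : ∃ a < r, ∃ k, RPath π x y a k := by
  obtain ⟨a, har, ha, c, hc, h0, h1⟩ := hX x y r h
  exact ⟨a, har, _, ha, c, hc, h0, h1, rfl⟩

/-- Equicontinuity: a common Lipschitz constant reduces uniform closeness on a compact set to
closeness at the centres of a finite cover. -/
theorem tendstoUniformlyOn_of_lipschitz {ι : Type*} {l : Filter ι} {c : ι → ℝ → X} {c' : ℝ → X}
    (hc : ∀ i, LipschitzWith 1 (c i)) (hc' : LipschitzWith 1 c')
    (h : ∀ t, Filter.Tendsto (fun i => c i t) l (𝓝 (c' t))) {s : Set ℝ} (hs : IsCompact s) {η : ℝ}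
    (hη : 0 < η) : ∀ᶠ i in l, ∀ t ∈ s, dist (c i t) (c' t) < η := by
  obtain ⟨F, hF⟩ := hs.elim_finite_subcover (fun t : ℝ => Metric.ball t (η / 3)) (fun _ => Metric.isOpen_ball)
    fun t _ => mem_iUnion.2 ⟨t, Metric.mem_ball_self (by positivity)⟩
  have : ∀ᶠ i in l, ∀ t ∈ F, dist (c i t) (c' t) < η / 3 :=
    (Filter.eventually_all_finset F).2 fun t _ =>
      (Metric.tendsto_nhds.1 (h t)) _ (by positivity)
  filter_upwards [this] with i hi t ht
  obtain ⟨u, hu, htu⟩ := mem_iUnion₂.1 (hF ht)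
  have h1 := (hc i).dist_le_mul t u
  have h2 := hc'.dist_le_mul u t
  have h3 := hi u hu
  rw [Metric.mem_ball] at htu
  rw [dist_comm] at h2
  rw [dist_comm u t] at h2
  simp only [NNReal.coe_one, one_mul] at h1 h2
  have := dist_triangle4 (c i t) (c i u) (c' u) (c' t)
  rw [dist_comm (c' u)] at this
  linarith

/-- A compact space contains a shortest loop along which `π` rises by an odd number. -/
theorem exists_shortest_odd_loop [CompactSpace X] (hπ : Continuous π) {x : X} {a : ℝ} {k : ℤ}
    (hk : Odd k) (h : RPath π x x a k) :
    ∃ b ≤ a, (∃ (y : X) (l : ℤ), Odd l ∧ RPath π y y b l) ∧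
      ∀ b' < b, ∀ (y : X) (l : ℤ), Odd l → ¬ RPath π y y b' l := by
  set A : Set ℝ := {b | ∃ (y : X) (l : ℤ), Odd l ∧ RPath π y y b l} with hA
  have hA0 : BddBelow A := ⟨0, by rintro b ⟨y, l, -, hb⟩; exact hb.1⟩
  have haA : a ∈ A := ⟨x, k, hk, h⟩
  refine ⟨sInf A, csInf_le hA0 haA, ?_, fun b' hb' y l hl hb => ?_⟩
  swap
  · exact absurd (csInf_le hA0 (show b' ∈ A from ⟨y, l, hl, hb⟩)) (not_le.2 hb')
  obtain ⟨b, -, hb, hbA⟩ := exists_seq_tendsto_sInf ⟨a, haA⟩ hA0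
  choose y l hl hb0 c hc hc0 hc1 hcl using hbA
  set β := sInf A with hβ
  have hβ0 : 0 ≤ β := ge_of_tendsto' hb hb0
  -- An ultrafilter limit at each parameter replaces the passage to a convergent subsequence of
  -- curves. The limit curve is 1-Lipschitz because the bound is closed under limits.
  let 𝒰 : Ultrafilter ℕ := Ultrafilter.of Filter.atTop
  have h𝒰 : (𝒰 : Filter ℕ) ≤ Filter.atTop := Ultrafilter.of_le _
  have hlim : ∀ t, ∃ z, Filter.Tendsto (fun n => c n t) 𝒰 (𝓝 z) := fun t => by
    obtain ⟨z, -, hz⟩ := isCompact_univ.ultrafilter_le_nhds (𝒰.map fun n => c n t)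
      (by simp)
    exact ⟨z, hz⟩
  choose c' hc' using hlim
  have hb' := hb.mono_left h𝒰
  have hL : LipschitzWith 1 c' := LipschitzWith.of_dist_le_mul fun s t =>
    le_of_tendsto' ((hc' s).dist (hc' t)) fun n => (hc n).dist_le_mul s t
  have hclose : c' 0 = c' β := by
    have h1 : Filter.Tendsto (fun n => dist (c n 0) (c n β)) 𝒰 (𝓝 (dist (c' 0) (c' β))) :=
      (hc' 0).dist (hc' β)
    have h2 : Filter.Tendsto (fun n => dist (c n 0) (c n β)) 𝒰 (𝓝 0) := by
      refine squeeze_zero (fun _ => dist_nonneg) (fun n => ?_)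
        (g := fun n => dist (b n) β) (by simpa using hb'.dist (tendsto_const_nhds (x := β)))
      rw [hc0, ← hc1 n]
      simpa using (hc n).dist_le_mul (b n) β
    exact dist_eq_zero.1 (tendsto_nhds_unique h1 h2)
  -- The bound `1 / 8` lies below the threshold `1 / 4` of `abs_rise_lt`. It is used twice, for the
  -- leftover piece between `β` and `b n` and for the difference to the limit curve; each error is
  -- below `1 / 2`, so the integers `l n` and `m` differ by less than 1.
  obtain ⟨η, hη, hηπ⟩ := Metric.uniformContinuous_iff.1
    (CompactSpace.uniformContinuous_of_continuous hπ) (1 / 8) (by norm_num)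
  have hev1 := tendstoUniformlyOn_of_lipschitz hc hL hc' (isCompact_Icc (a := 0) (b := β)) hη
  have hev2 : ∀ᶠ n in (𝒰 : Filter ℕ), dist (b n) β < η := Metric.tendsto_nhds.1 hb' _ hη
  obtain ⟨n, hn1, hn2⟩ := (hev1.and hev2).exists
  have hcont : ∀ n, Continuous fun t => π (c n t) := fun n => hπ.comp' (hc n).continuous
  have hcont' : Continuous fun t => π (c' t) := hπ.comp' hL.continuous
  have e1 := rise_add_adjacent (hcont n) 0 β (b n)
  rw [hcl] at e1
  have e2 : |rise (fun t => π (c n t)) β (b n)| < 1 / 2 := by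
    -- `abs_rise_lt` needs values near `0`, so the constant `π (c n β)` is subtracted first; this
    -- leaves the rise unchanged.
    have hshift := rise_add ((hcont n).sub (continuous_const (y := π (c n β))))
      (continuous_const (y := π (c n β))) β (b n)
    simp only [Pi.sub_apply, sub_add_cancel, rise_const, add_zero] at hshift
    rw [hshift]
    refine abs_rise_lt ((hcont n).sub continuous_const) fun t ht => ?_
    have : dist (c n t) (c n β) < η := by
      refine lt_of_le_of_lt ((hc n).dist_le_mul t β) ?_
      simp only [NNReal.coe_one, one_mul]
      refine lt_of_le_of_lt ?_ hn2
      rw [Real.dist_eq, Real.dist_eq]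
      exact abs_sub_left_of_mem_uIcc ht
    have := hηπ this
    rw [dist_eq_norm] at this
    simp only [Pi.sub_apply]
    linarith
  have e3 : |rise (fun t => π (c n t) - π (c' t)) 0 β| < 1 / 2 := by
    refine abs_rise_lt ((hcont n).sub hcont') fun t ht => ?_
    rw [uIcc_of_le hβ0] at ht
    have := hηπ (hn1 t ht)
    rw [dist_eq_norm] at this
    simp only [Pi.sub_apply]
    linarith
  have e4 := rise_add ((hcont n).sub hcont') hcont' 0 β
  simp only [Pi.sub_apply, sub_add_cancel] at e4
  obtain ⟨m, hm⟩ := exists_int_rise hcont' (s := 0) (t := β) (by rw [hclose])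
  refine ⟨c' 0, m, ?_, hβ0, c', hL, rfl, hclose.symm, hm⟩
  have e5 : |(l n : ℝ) - m| < 1 := by
    change rise _ 0 β = rise (fun t => π (c n t) - π (c' t)) 0 β + _ at e4
    rw [hm] at e4
    rw [e4] at e1
    rw [show (l n : ℝ) - m = rise (fun t => π (c n t) - π (c' t)) 0 β
      + rise (fun t => π (c n t)) β (b n) by linarith]
    exact lt_of_le_of_lt (abs_add_le _ _) (by linarith)
  have e6 : |l n - m| < 1 := by exact_mod_cast e5
  rw [← sub_eq_zero.1 (Int.abs_lt_one_iff.1 e6)]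
  exact hl n

/-- The shortest loop along which `π` rises by an odd number is an isometric circle. -/
theorem exists_isometric_circle [CompactSpace X] (hX : IsLengthSpace X) (hπ : Continuous π)
    {x : X} {a : ℝ} {k : ℤ} (hk : Odd k) (h : RPath π x x a k) :
    ∃ b : ℝ, 0 < b ∧ b ≤ a ∧ ∃ c : AddCircle b → X, Isometry c ∧
      ∃ l : ℤ, Odd l ∧ rise (fun t : ℝ => π (c t)) 0 b = l := by
  obtain ⟨b, hba, ⟨y, l, hl, hb0, c, hc, rfl, hcb, hcl⟩, hmin⟩ := exists_shortest_odd_loop hπ hk h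
  have hb : 0 < b := by
    refine lt_of_le_of_ne hb0 fun h0 => ?_
    subst h0
    obtain ⟨g, hg, hgf⟩ := exists_circle_lift (hπ.comp' hc.continuous)
    rw [rise_eq' hg hgf, sub_self] at hcl
    have : l = 0 := by exact_mod_cast hcl.symm
    subst this
    simp at hl
  have hcont : Continuous fun t => π (c t) := hπ.comp' hc.continuous
  have hd1 : ∀ s t, dist (c s) (c t) ≤ |s - t| := fun s t => by
    simpa [Real.dist_eq] using hc.dist_le_mul s t
  have key : ∀ s t, 0 ≤ s → s ≤ t → t ≤ b → dist (c s) (c t) = min (t - s) (b - (t - s)) := by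
    intro s t hs hst ht
    apply le_antisymm
    · refine le_min ((hd1 s t).trans ?_) ?_
      · rw [abs_of_nonpos (by linarith)]
        linarith
      · refine (dist_triangle _ (c 0) _).trans ?_
        have h1 := hd1 s 0
        have h2 := hd1 b t
        rw [hcb] at h2
        rw [abs_of_nonneg (by linarith)] at h1 h2
        linarith
    · by_contra! hlt
      -- A path `γ` shorter than both parts of the loop between `c s` and `c t` closes each part up
      -- to a loop shorter than `b`. The rises of these two loops add up to the odd number `l`, so
      -- one of them is odd, against minimality.
      obtain ⟨r, hr, k', hγ⟩ := hX.exists_rPath π hlt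
      have p1 := rPath_of_lipschitz hπ hc hs
      have p2 := rPath_of_lipschitz hπ hc hst
      have p3 := rPath_of_lipschitz hπ hc ht
      rw [hcb] at p3
      have l1 := p2.trans hπ (hγ.symm hπ)
      have l2 := (p1.trans hπ hγ).trans hπ p3
      have e1 := rise_add_adjacent hcont 0 s t
      have e2 := rise_add_adjacent hcont 0 t b
      obtain ⟨m, hm⟩ : ∃ m : ℤ, rise (fun t => π (c t)) s t + -k' = m := by
        obtain ⟨-, c', hc', h0, h1, h2⟩ := l1
        rw [← h2]
        exact exists_int_rise (hπ.comp' hc'.continuous) (by rw [h0, h1])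
      rw [hm] at l1
      have hm' : rise (fun t => π (c t)) 0 s + k' + rise (fun t => π (c t)) t b
          = ((l - m : ℤ) : ℝ) := by
        push_cast
        rw [← hm, ← hcl]
        linarith
      rw [hm'] at l2
      have n1 := hmin _ (by linarith [min_le_right (t - s) (b - (t - s))]) _ _ |>.mt (not_not.2 l1)
      have n2 := hmin _ (by linarith [min_le_left (t - s) (b - (t - s))]) _ _ |>.mt (not_not.2 l2)
      rw [Int.not_odd_iff_even] at n1 n2
      have := n1.add n2
      rw [add_sub_cancel] at this
      exact Int.not_even_iff_odd.2 hl this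
  have : Fact (0 < b) := ⟨hb⟩
  have hlift : ∀ t ∈ Icc 0 b, AddCircle.liftIco b 0 c (t : AddCircle b) = c t := by
    intro t ht
    rcases ht.2.lt_or_eq with hlt | rfl
    · exact AddCircle.liftIco_zero_coe_apply ⟨ht.1, hlt⟩
    · rw [AddCircle.coe_period, ← AddCircle.coe_zero, AddCircle.liftIco_zero_coe_apply ⟨le_rfl, hb⟩,
        hcb]
  have hiso : Isometry (AddCircle.liftIco b 0 c) := by
    refine Isometry.of_dist_eq fun p q => ?_
    obtain ⟨s, hs, rfl⟩ := (AddCircle.eq_coe_Ico p)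
    obtain ⟨t, ht, rfl⟩ := (AddCircle.eq_coe_Ico q)
    wlog hst : s ≤ t generalizing s t
    · rw [dist_comm, this t ht s hs (le_of_not_ge hst), dist_comm]
    rw [hlift s ⟨hs.1, hs.2.le⟩, hlift t ⟨ht.1, ht.2.le⟩, key s t hs.1 hst ht.2.le, dist_comm,
      dist_eq_norm, ← AddCircle.coe_sub]
    rcases le_total (t - s) (b / 2) with h2 | h2
    · rw [(AddCircle.norm_coe_eq_abs_iff b hb.ne').2, abs_of_nonneg (by linarith),
        min_eq_left (by linarith)]
      rw [abs_of_nonneg (by linarith), abs_of_pos hb]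
      exact h2
    · rw [min_eq_right (by linarith), ← norm_neg, ← AddCircle.coe_neg,
        show ((-(t - s) : ℝ) : AddCircle b) = ((b - (t - s) : ℝ) : AddCircle b) by
          rw [AddCircle.coe_sub b, AddCircle.coe_period, zero_sub, AddCircle.coe_neg],
        (AddCircle.norm_coe_eq_abs_iff b hb.ne').2, abs_of_nonneg (by linarith [hs.1, ht.2])]
      rw [abs_of_nonneg (by linarith [hs.1, ht.2]), abs_of_pos hb]
      linarith
  refine ⟨b, hb, hba, _, hiso, l, hl, ?_⟩
  rw [← hcl]
  refine rise_congr ?_ hcont fun t ht => ?_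
  · exact hπ.comp' (hiso.continuous.comp (AddCircle.continuous_mk' b))
  · rw [uIcc_of_le hb0] at ht
    rw [hlift t ht]

end Curves

/-! ### Points of `|G|` and their barycentric coordinates -/

section Points

variable {V : Type u} {G : SimpleGraph V}

/-- The barycentric coordinates of a point; those of an end are `0`. -/
noncomputable def wt : Space G → V → ℝ
  | .inG p => p.coord
  | .atEnd _ => 0

open Classical in
/-- A vertex, as a point of `|G|`. -/
noncomputable def vertexPoint (G : SimpleGraph V) (v : V) : Space G :=
  .inG ⟨Pi.single v 1, Or.inl ⟨v, rfl⟩⟩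

/-- The first endvertex of an edge in its reference orientation. -/
noncomputable def src (e : G.edgeSet) : V := (Quot.out (e : Sym2 V)).1

/-- The second endvertex of an edge in its reference orientation. -/
noncomputable def tgt (e : G.edgeSet) : V := (Quot.out (e : Sym2 V)).2

theorem adj_src_tgt (e : G.edgeSet) : G.Adj (src e) (tgt e) := adj_out e

theorem src_ne_tgt (e : G.edgeSet) : src e ≠ tgt e := (adj_out e).ne

theorem mk_src_tgt (e : G.edgeSet) : s(src e, tgt e) = (e : Sym2 V) :=
  Quot.out_eq (e : Sym2 V)

/-- The point of the edge `e` with parameter `t`. -/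
noncomputable def epoint (e : G.edgeSet) (t : I) : Space G := edgePoint (adj_out e) t

theorem inG_ext {x y : Space G} (hx : ∀ ω, x ≠ .atEnd ω) (hy : ∀ ω, y ≠ .atEnd ω)
    (h : wt x = wt y) : x = y := by
  rcases x with p | ω
  · rcases y with q | ω
    · congr 1
      exact OneComplex.ext h
    · exact absurd rfl (hy ω)
  · exact absurd rfl (hx ω)

@[simp] theorem vertexPoint_ne_atEnd (v : V) (ω : GraphEnd G) : vertexPoint G v ≠ .atEnd ω := by
  simp [vertexPoint]

@[simp] theorem edgePoint_ne_atEnd {u v : V} (h : G.Adj u v) (t : I) (ω : GraphEnd G) :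
    edgePoint h t ≠ .atEnd ω := by
  simp [edgePoint]

@[simp] theorem wt_atEnd (ω : GraphEnd G) : wt (.atEnd ω) = 0 := rfl

open Classical in
theorem wt_vertexPoint (v x : V) : wt (vertexPoint G v) x = if x = v then 1 else 0 := by
  simp [wt, vertexPoint, Pi.single_apply]

open Classical in
theorem wt_edgePoint {u v : V} (h : G.Adj u v) (t : I) (x : V) :
    wt (edgePoint h t) x = if x = u then 1 - (t : ℝ) else if x = v then (t : ℝ) else 0 := by
  have := h.ne
  simp only [wt, edgePoint, Pi.add_apply, Pi.smul_apply, Pi.single_apply, smul_eq_mul]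
  split_ifs <;> simp_all

theorem wt_edgePoint_left {u v : V} (h : G.Adj u v) (t : I) :
    wt (edgePoint h t) u = 1 - (t : ℝ) := by
  simp [wt_edgePoint]

theorem wt_edgePoint_right {u v : V} (h : G.Adj u v) (t : I) :
    wt (edgePoint h t) v = (t : ℝ) := by
  simp [wt_edgePoint, h.ne.symm]

theorem wt_edgePoint_of_ne {u v x : V} (h : G.Adj u v) (t : I) (hu : x ≠ u) (hv : x ≠ v) :
    wt (edgePoint h t) x = 0 := by
  simp [wt_edgePoint, hu, hv]

theorem edgePoint_symm {u v : V} (h : G.Adj u v) (t : I) :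
    edgePoint h.symm t = edgePoint h (unitInterval.symm t) := by
  have := h.ne
  refine inG_ext (by simp) (by simp) (funext fun x => ?_)
  simp only [wt_edgePoint, unitInterval.coe_symm_eq]
  split_ifs <;> simp_all

@[simp] theorem edgePoint_zero {u v : V} (h : G.Adj u v) : edgePoint h 0 = vertexPoint G u := by
  refine inG_ext (by simp) (by simp) (funext fun x => ?_)
  simp [wt_edgePoint, wt_vertexPoint]

@[simp] theorem edgePoint_one {u v : V} (h : G.Adj u v) : edgePoint h 1 = vertexPoint G v := by
  have := h.ne
  refine inG_ext (by simp) (by simp) (funext fun x => ?_)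
  simp only [wt_edgePoint, wt_vertexPoint]
  split_ifs <;> simp_all

@[simp] theorem epoint_zero (e : G.edgeSet) : epoint e 0 = vertexPoint G (src e) := edgePoint_zero _

@[simp] theorem epoint_one (e : G.edgeSet) : epoint e 1 = vertexPoint G (tgt e) := edgePoint_one _

@[simp] theorem epoint_ne_atEnd (e : G.edgeSet) (t : I) (ω : GraphEnd G) :
    epoint e t ≠ .atEnd ω := edgePoint_ne_atEnd _ _ _

theorem wt_epoint_src (e : G.edgeSet) (t : I) : wt (epoint e t) (src e) = 1 - (t : ℝ) :=
  wt_edgePoint_left _ _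

theorem wt_epoint_tgt (e : G.edgeSet) (t : I) : wt (epoint e t) (tgt e) = (t : ℝ) :=
  wt_edgePoint_right _ _

theorem wt_epoint_of_ne {e : G.edgeSet} {x : V} (t : I) (hu : x ≠ src e) (hv : x ≠ tgt e) :
    wt (epoint e t) x = 0 := wt_edgePoint_of_ne _ _ hu hv

theorem epoint_injective (e : G.edgeSet) : Function.Injective (epoint e) := fun s t h => by
  have := congrArg (fun x => wt x (tgt e)) h
  simp only [wt_epoint_tgt] at this
  exact Subtype.ext this

theorem edge_cases {u v : V} (h : G.Adj u v) :
    ∃ e : G.edgeSet, (e : Sym2 V) = s(u, v) ∧ ((u = src e ∧ v = tgt e ∧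
      ∀ t, edgePoint h t = epoint e t) ∨
      (v = src e ∧ u = tgt e ∧ ∀ t, edgePoint h t = epoint e (unitInterval.symm t))) := by
  classical
  refine ⟨⟨s(u, v), h⟩, rfl, ?_⟩
  rcases Sym2.eq_iff.1 (mk_src_tgt (⟨s(u, v), h⟩ : G.edgeSet)) with ⟨h1, h2⟩ | ⟨h1, h2⟩
  · refine Or.inl ⟨h1.symm, h2.symm, fun t => ?_⟩
    refine inG_ext (by simp) (by simp) (funext fun x => ?_)
    rw [epoint, wt_edgePoint, wt_edgePoint]
    change _ = if x = src _ then _ else if x = tgt _ then _ else _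
    rw [h1, h2]
  · refine Or.inr ⟨h1.symm, h2.symm, fun t => ?_⟩
    rw [← unitInterval.symm_symm t, ← edgePoint_symm h, unitInterval.symm_symm]
    refine inG_ext (by simp) (by simp) (funext fun x => ?_)
    rw [epoint, wt_edgePoint, wt_edgePoint]
    change _ = if x = src _ then _ else if x = tgt _ then _ else _
    rw [h1, h2]

theorem mem_edge_iff {e : G.edgeSet} {x : V} : x ∈ (e : Sym2 V) ↔ x = src e ∨ x = tgt e := by
  rw [← mk_src_tgt, Sym2.mem_iff]

theorem edgePoints_eq_range (e : G.edgeSet) : edgePoints e = range (epoint e) := by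
  ext x
  constructor
  · rintro ⟨u, v, h, he, t, rfl⟩
    obtain ⟨e', he', h' | h'⟩ := edge_cases h
    · have : e' = e := Subtype.ext (he'.trans he)
      subst this
      exact ⟨t, (h'.2.2 t).symm⟩
    · have : e' = e := Subtype.ext (he'.trans he)
      subst this
      exact ⟨_, (h'.2.2 t).symm⟩
  · rintro ⟨t, rfl⟩
    exact ⟨_, _, adj_out e, mk_src_tgt e, t, rfl⟩

theorem space_cases (x : Space G) :
    (∃ v, x = vertexPoint G v) ∨ (∃ (e : G.edgeSet) (t : I), x = epoint e t) ∨
      ∃ ω, x = .atEnd ω := by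
  classical
  rcases x with ⟨p, hp⟩ | ω
  · rcases hp with ⟨v, rfl⟩ | ⟨a, b, h, s, t, hs, ht, hst, rfl⟩
    · exact Or.inl ⟨v, inG_ext (by simp) (by simp) (funext fun x => by
        rw [wt_vertexPoint]; simp [wt, Pi.single_apply])⟩
    · right; left
      have key : (Space.inG ⟨s • Pi.single a 1 + t • Pi.single b 1,
          Or.inr ⟨a, b, h, s, t, hs, ht, hst, rfl⟩⟩ : Space G)
          = edgePoint h ⟨t, ht, by linarith⟩ := by
        have := h.ne
        refine inG_ext (by simp) (by simp) (funext fun x => ?_)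
        rw [wt_edgePoint]
        simp only [wt, Pi.add_apply, Pi.smul_apply, Pi.single_apply, smul_eq_mul]
        have : s = 1 - t := by linarith
        split_ifs <;> simp_all
      obtain ⟨e, -, h' | h'⟩ := edge_cases h
      · exact ⟨e, _, (key.trans (h'.2.2 _))⟩
      · exact ⟨e, _, (key.trans (h'.2.2 _))⟩
  · exact Or.inr (Or.inr ⟨ω, rfl⟩)

theorem isOpen_iff_epoint {U : Set (Space G)} :
    IsOpen U ↔ (∀ e : G.edgeSet, IsOpen {t : I | epoint e t ∈ U}) ∧
      ∀ ω : GraphEnd G, Space.atEnd ω ∈ U → ∃ S : Finset V, endRegion G S ω ⊆ U := by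
  constructor
  · rintro ⟨h1, h2⟩
    exact ⟨fun e => h1 _ _ (adj_out e), h2⟩
  · rintro ⟨h1, h2⟩
    refine ⟨fun a b h => ?_, h2⟩
    obtain ⟨e, -, h' | h'⟩ := edge_cases h
    · simpa only [h'.2.2] using h1 e
    · simp only [h'.2.2]
      exact (h1 e).preimage unitInterval.continuous_symm

/-- The functions needed here see only finitely many vertices or edges, or are constant beyond a
finite cut, so near an end they are constant. This strong condition spares any study of
neighbourhoods of ends. -/
theorem continuous_of_epoint {Y : Type*} [TopologicalSpace Y] {f : Space G → Y}
    (h1 : ∀ e : G.edgeSet, Continuous fun t => f (epoint e t))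
    (h2 : ∀ ω, ∃ S : Finset V, ∀ x ∈ endRegion G S ω, f x = f (.atEnd ω)) : Continuous f := by
  refine continuous_def.2 fun U hU => isOpen_iff_epoint.2 ⟨fun e => hU.preimage (h1 e), ?_⟩
  intro ω hω
  obtain ⟨S, hS⟩ := h2 ω
  exact ⟨S, fun x hx => by rw [mem_preimage, hS x hx]; exact hω⟩

theorem continuous_epoint (e : G.edgeSet) : Continuous (epoint e) :=
  continuous_def.2 fun _ hU => (isOpen_iff_epoint.1 hU).1 e

theorem notMem_endComponent {S : Finset V} {ω : GraphEnd G} {x : V} (hx : x ∈ S) :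
    x ∉ endComponent G S ω := by
  rintro ⟨R, -, N, hN⟩
  obtain ⟨p, hp⟩ := hN N le_rfl
  exact hp x p.start_mem_support hx

theorem wt_eq_zero_of_mem_endRegion {S : Finset V} {ω : GraphEnd G} {x : Space G}
    (hx : x ∈ endRegion G S ω) {v : V} (hv : v ∈ S) : wt x v = 0 := by
  rcases x with p | η
  · by_contra h
    exact notMem_endComponent hv (hx v h)
  · rfl

theorem continuous_wt (v : V) : Continuous fun x : Space G => wt x v := by
  classical
  refine continuous_of_epoint (fun e => ?_) fun ω => ⟨{v}, fun x hx => ?_⟩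
  · by_cases h1 : v = src e
    · subst h1
      simp only [wt_epoint_src]
      fun_prop
    · by_cases h2 : v = tgt e
      · subst h2
        simp only [wt_epoint_tgt]
        fun_prop
      · simp only [wt_epoint_of_ne _ h1 h2]
        exact continuous_const
  · rw [wt_eq_zero_of_mem_endRegion hx (by simp)]
    rfl

/-! ### The coordinate of an edge -/

open Classical in
/-- The coordinate of the edge `e` as a map to the circle that collapses everything else. -/
noncomputable def edgeCoord (e : G.edgeSet) (x : Space G) : UnitAddCircle :=
  if wt x (src e) = 0 then 0 else (wt x (tgt e) : ℝ)

@[simp] theorem edgeCoord_atEnd (e : G.edgeSet) (ω : GraphEnd G) :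
    edgeCoord e (.atEnd ω) = 0 := by
  simp [edgeCoord]

@[simp] theorem edgeCoord_vertexPoint (e : G.edgeSet) (v : V) :
    edgeCoord e (vertexPoint G v) = 0 := by
  simp only [edgeCoord, wt_vertexPoint]
  have := src_ne_tgt e
  split_ifs <;> simp_all

@[simp] theorem edgeCoord_epoint_self (e : G.edgeSet) (t : I) :
    edgeCoord e (epoint e t) = (t : ℝ) := by
  simp only [edgeCoord, wt_epoint_src, wt_epoint_tgt]
  split_ifs with h
  · rw [show (t : ℝ) = 1 by linarith]
    exact (AddCircle.coe_period 1).symm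
  · rfl

theorem wt_epoint_of_edge_ne {e e' : G.edgeSet} (h : e ≠ e') (t : I) :
    wt (epoint e' t) (src e) = 0 ∨ wt (epoint e' t) (tgt e) = 0 := by
  by_contra! hne
  have h1 : src e ∈ (e' : Sym2 V) := by
    rw [mem_edge_iff]
    by_contra! hc
    exact hne.1 (wt_epoint_of_ne t hc.1 hc.2)
  have h2 : tgt e ∈ (e' : Sym2 V) := by
    rw [mem_edge_iff]
    by_contra! hc
    exact hne.2 (wt_epoint_of_ne t hc.1 hc.2)
  refine h (Subtype.ext ?_)
  rw [← mk_src_tgt e]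
  exact ((Sym2.mem_and_mem_iff (src_ne_tgt e)).1 ⟨h1, h2⟩).symm

theorem edgeCoord_epoint_of_ne {e e' : G.edgeSet} (h : e ≠ e') (t : I) :
    edgeCoord e (epoint e' t) = 0 := by
  simp only [edgeCoord]
  split_ifs with h0
  · rfl
  · rw [(wt_epoint_of_edge_ne h t).resolve_left h0, AddCircle.coe_zero]

theorem continuous_edgeCoord (e : G.edgeSet) : Continuous (edgeCoord e) := by
  classical
  refine continuous_of_epoint (fun e' => ?_) fun ω => ⟨{src e}, fun x hx => ?_⟩
  · by_cases h : e = e'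
    · subst h
      simp only [edgeCoord_epoint_self]
      exact (AddCircle.continuous_mk' 1).comp continuous_subtype_val
    · simp only [edgeCoord_epoint_of_ne h]
      exact continuous_const
  · rw [edgeCoord_atEnd, edgeCoord, if_pos (wt_eq_zero_of_mem_endRegion hx (by simp))]

theorem coe_ne_zero_of_mem_Ioo {t : ℝ} (h : t ∈ Ioo (0 : ℝ) 1) : (t : UnitAddCircle) ≠ 0 := by
  intro h0
  rw [← AddCircle.coe_zero, coe_eq_coe_iff_int] at h0
  obtain ⟨k, hk⟩ := h0
  have h1 : (0 : ℝ) < k := by linarith [h.1]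
  have h2 : (k : ℝ) < 1 := by linarith [h.2]
  have h1' : 0 < k := by exact_mod_cast h1
  have h2' : k < 1 := by exact_mod_cast h2
  omega

theorem exists_of_edgeCoord_ne_zero {e : G.edgeSet} {x : Space G} (h : edgeCoord e x ≠ 0) :
    ∃ t : I, x = epoint e t := by
  obtain ⟨v, rfl⟩ | ⟨e', t, rfl⟩ | ⟨ω, rfl⟩ := space_cases x
  · simp at h
  · by_cases he : e = e'
    · subst he
      exact ⟨t, rfl⟩
    · exact absurd (edgeCoord_epoint_of_ne he t) h
  · simp at h

/-- The collapsing map is injective away from `0`, since only the interior of `e` is mapped there.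
-/
theorem eq_of_edgeCoord_eq {e : G.edgeSet} {x y : Space G} (h : edgeCoord e x ≠ 0)
    (hxy : edgeCoord e x = edgeCoord e y) : x = y := by
  obtain ⟨s, rfl⟩ := exists_of_edgeCoord_ne_zero h
  obtain ⟨t, rfl⟩ := exists_of_edgeCoord_ne_zero (hxy ▸ h)
  simp only [edgeCoord_epoint_self] at h hxy
  have hs1 : (s : ℝ) ≠ 1 := fun h1 => h (by rw [h1]; exact AddCircle.coe_period 1)
  have ht1 : (t : ℝ) ≠ 1 := fun h1 => h (by rw [hxy, h1]; exact AddCircle.coe_period 1)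
  congr 1
  apply Subtype.ext
  refine (AddCircle.coe_eq_coe_iff_of_mem_Ico (p := 1) (a := 0) ?_ ?_).1 hxy
  · exact ⟨s.2.1, by simpa using lt_of_le_of_ne s.2.2 hs1⟩
  · exact ⟨t.2.1, by simpa using lt_of_le_of_ne t.2.2 ht1⟩

end Points

/-! ### Edges traversed by a circle -/

section Crossing

/-- `hinj` says that no irrational value is attained twice modulo 1. If `g` climbed by 2, both `θ`
and `θ + 1` would be attained for some irrational `θ`. Irrational values are dense, stable under
integer shifts and sign change, and avoid the point `0` at which the coordinate of an edge fails to
be injective. -/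
theorem not_two_le_of_inj {g : ℝ → ℝ} (hg : Continuous g) {a : ℝ} (ha : 0 < a)
    (hinj : ∀ s ∈ Ioo 0 a, ∀ t ∈ Ioo 0 a, s ≠ t → ∀ n : ℤ, g s - g t = n → ¬ Irrational (g s)) :
    g a < g 0 + 2 := by
  by_contra! h
  obtain ⟨θ, hθ, h1, h2⟩ := exists_irrational_btwn (show g 0 < g 0 + 1 by linarith)
  have hsub := intermediate_value_Ioo ha.le hg.continuousOn
  obtain ⟨s, hs, hsθ⟩ := hsub (show θ + (1 : ℤ) ∈ Ioo (g 0) (g a) by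
    push_cast; constructor <;> linarith)
  obtain ⟨t, ht, htθ⟩ := hsub (show θ ∈ Ioo (g 0) (g a) by constructor <;> linarith)
  refine hinj s hs t ht ?_ 1 (by rw [hsθ, htθ]; ring) (by rw [hsθ]; exact hθ.add_intCast 1)
  rintro rfl
  rw [hsθ] at htθ
  norm_num at htθ

theorem le_of_inj_of_eq {g : ℝ → ℝ} (hg : Continuous g) {a : ℝ}
    (hinj : ∀ s ∈ Ioo 0 a, ∀ t ∈ Ioo 0 a, s ≠ t → ∀ n : ℤ, g s - g t = n → ¬ Irrational (g s))
    (h0 : g a = g 0) {r : ℝ} (hr : r ∈ Ioo 0 a) : g r ≤ g 0 := by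
  by_contra! h
  obtain ⟨θ, hθ, h1, h2⟩ := exists_irrational_btwn h
  obtain ⟨s, hs, hsθ⟩ := intermediate_value_Ioo hr.1.le hg.continuousOn
    (show θ ∈ Ioo (g 0) (g r) from ⟨h1, h2⟩)
  obtain ⟨t, ht, htθ⟩ := intermediate_value_Ioo' hr.2.le hg.continuousOn
    (show θ ∈ Ioo (g a) (g r) from ⟨h0 ▸ h1, h2⟩)
  refine hinj s ⟨hs.1, hs.2.trans hr.2⟩ t ⟨hr.1.trans ht.1, ht.2⟩ (hs.2.trans ht.1).ne 0
    (by rw [hsθ, htθ]; simp) (by rwa [hsθ])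

/-- A closed curve in the circle that is nonconstant and takes generic values at most once has odd
rise. -/
theorem odd_of_inj {g : ℝ → ℝ} (hg : Continuous g) {a : ℝ} (ha : 0 < a)
    (hinj : ∀ s ∈ Ioo 0 a, ∀ t ∈ Ioo 0 a, s ≠ t → ∀ n : ℤ, g s - g t = n → ¬ Irrational (g s))
    {k : ℤ} (hk : g a - g 0 = k) {r : ℝ} (hr : r ∈ Ioo 0 a) (hne : g r ≠ g 0) : Odd k := by
  have hinj' : ∀ s ∈ Ioo 0 a, ∀ t ∈ Ioo 0 a, s ≠ t → ∀ n : ℤ, (-g) s - (-g) t = n →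
      ¬ Irrational ((-g) s) := fun s hs t ht hst n hn hirr =>
    hinj s hs t ht hst (-n) (by
      simp only [Pi.neg_apply] at hn
      push_cast
      rw [← hn]
      ring) (irrational_neg_iff.1 hirr)
  have h1 := not_two_le_of_inj hg ha hinj
  have h2 := not_two_le_of_inj hg.neg ha hinj'
  simp only [Pi.neg_apply] at h2
  have h3 : k < 2 := by
    have : (k : ℝ) < 2 := by linarith
    exact_mod_cast this
  have h4 : -2 < k := by
    have : (-2 : ℝ) < k := by linarith
    exact_mod_cast this
  have h5 : k ≠ 0 := by
    rintro rfl
    have h0 : g a = g 0 := by push_cast at hk; linarith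
    have l1 := le_of_inj_of_eq hg hinj h0 hr
    have l2 := le_of_inj_of_eq hg.neg hinj' (by simp [h0]) hr
    simp only [Pi.neg_apply] at l2
    exact hne (by linarith)
  obtain rfl | rfl : k = 1 ∨ k = -1 := by omega
  · exact odd_one
  · exact ⟨-1, by norm_num⟩

variable {V : Type u} {G : SimpleGraph V}

theorem mem_edgesIn_iff {e : G.edgeSet} {C : Set (Space G)} :
    e ∈ edgesIn C ↔ ∀ t, epoint e t ∈ C := by
  rw [edgesIn, mem_ofPred_eq, edgePoints_eq_range]
  exact range_subset_iff

/-- A circle contains an edge if and only if it runs through it an odd number of times. -/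
theorem mem_edgesIn_range_iff [T2Space (Space G)] {a : ℝ} (ha : 0 < a) {ρ : AddCircle a → Space G}
    (hρ : Continuous ρ) (hinj : Function.Injective ρ) (e : G.edgeSet) {k : ℤ}
    (hk : rise (fun t : ℝ => edgeCoord e (ρ t)) 0 a = k) :
    e ∈ edgesIn (range ρ) ↔ Odd k := by
  have : Fact (0 < a) := ⟨ha⟩
  have hρ' : Continuous fun t : ℝ => ρ t := hρ.comp (AddCircle.continuous_mk' a)
  obtain ⟨g, hg, hgf⟩ := exists_circle_lift ((continuous_edgeCoord e).comp' hρ')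
  rw [rise_eq' hg hgf] at hk
  constructor
  · intro he
    rw [mem_edgesIn_iff] at he
    -- The coordinate is not constant along the circle: it is `0` at an endvertex of `e` and `1 / 2`
    -- at the midpoint, and both points lie on the circle.
    have hex : ∃ r ∈ Ioo 0 a, g r ≠ g 0 := by
      by_contra! hc
      have hall : ∀ p : AddCircle a, edgeCoord e (ρ p) = g 0 := fun p => by
        obtain ⟨t, ht, rfl⟩ := AddCircle.eq_coe_Ico p
        rw [← hgf]
        rcases ht.1.eq_or_lt with rfl | h0
        · rfl
        · rw [hc t ⟨h0, ht.2⟩]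
      obtain ⟨p, hp⟩ := he 0
      obtain ⟨q, hq⟩ := he ⟨1 / 2, by norm_num, by norm_num⟩
      have h1 := hall p
      have h2 := hall q
      rw [← h1, hp, hq, edgeCoord_epoint_self, edgeCoord_epoint_self] at h2
      exact coe_ne_zero_of_mem_Ioo (t := 1 / 2) (by norm_num) (by simpa using h2)
    obtain ⟨r, hr, hne⟩ := hex
    refine odd_of_inj hg ha (fun s hs t ht hst n hn hirr => hst ?_) hk hr hne
    have h1 : edgeCoord e (ρ s) = edgeCoord e (ρ t) := by
      rw [← hgf, ← hgf]
      exact coe_eq_coe_iff_int.2 ⟨n, hn⟩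
    have h2 : edgeCoord e (ρ s) ≠ 0 := fun h0 => by
      rw [← hgf, ← AddCircle.coe_zero, coe_eq_coe_iff_int] at h0
      obtain ⟨m, hm⟩ := h0
      rw [sub_zero] at hm
      rw [hm] at hirr
      exact m.not_irrational hirr
    have h3 := hinj (eq_of_edgeCoord_eq h2 h1)
    exact (AddCircle.coe_eq_coe_iff_of_mem_Ico (p := a) (a := 0)
      ⟨hs.1.le, by simpa using hs.2⟩ ⟨ht.1.le, by simpa using ht.2⟩).1 h3
  · intro hodd
    -- An odd rise is nonzero, so the lift covers an interval of length 1 and every coordinate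
    -- occurs. The circle therefore contains the interior of `e` and, being closed, also the
    -- endvertices.
    have hsurj : ∀ z : UnitAddCircle, ∃ p, edgeCoord e (ρ p) = z := by
      intro z
      have hlen : g 0 + 1 ≤ g a ∨ g a + 1 ≤ g 0 := by
        have hk0 : k ≠ 0 := by
          rintro rfl
          simp at hodd
        rcases lt_or_gt_of_ne hk0 with h | h
        · right
          have : (k : ℝ) ≤ -1 := by exact_mod_cast (by omega : k ≤ -1)
          linarith
        · left
          have : (1 : ℝ) ≤ k := by exact_mod_cast (by omega : 1 ≤ k)
          linarith
      have hsub := intermediate_value_uIcc (hg.continuousOn (s := uIcc 0 a))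
      have hm : ∃ x : ℝ, (x : UnitAddCircle) = z ∧ x ∈ uIcc (g 0) (g a) := by
        have : Fact (0 < (1 : ℝ)) := ⟨one_pos⟩
        rcases hlen with h | h
        · obtain ⟨x, hx, rfl⟩ := (AddCircle.coe_image_Ico_eq (1 : ℝ) (g 0)).symm ▸ mem_univ z
          exact ⟨x, rfl, mem_uIcc.2 (Or.inl ⟨hx.1, by linarith [hx.2]⟩)⟩
        · obtain ⟨x, hx, rfl⟩ := (AddCircle.coe_image_Ico_eq (1 : ℝ) (g a)).symm ▸ mem_univ z
          exact ⟨x, rfl, mem_uIcc.2 (Or.inr ⟨hx.1, by linarith [hx.2]⟩)⟩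
      obtain ⟨x, rfl, hx⟩ := hm
      obtain ⟨t, -, rfl⟩ := hsub hx
      exact ⟨t, (hgf t).symm⟩
    have hclosed : IsClosed (range ρ) := (isCompact_range hρ).isClosed
    have hsub : Ioo (0 : I) 1 ⊆ epoint e ⁻¹' range ρ := fun t ht => by
      obtain ⟨p, hp⟩ := hsurj (t : ℝ)
      refine ⟨p, eq_of_edgeCoord_eq ?_ (by rw [hp, edgeCoord_epoint_self])⟩
      rw [hp]
      exact coe_ne_zero_of_mem_Ioo ⟨ht.1, ht.2⟩
    rw [mem_edgesIn_iff]
    intro t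
    have := closure_minimal hsub (hclosed.preimage (continuous_epoint e))
    rw [closure_Ioo zero_ne_one] at this
    exact this ⟨t.2.1, t.2.2⟩

end Crossing

/-! ### Parity of edge sets on finite cuts -/

section Cuts

variable {V : Type u} {G : SimpleGraph V}

/-- The edges with exactly one endvertex in `A`. -/
def cutEdges (G : SimpleGraph V) (A : Set V) : Set G.edgeSet := {e | ¬ (src e ∈ A ↔ tgt e ∈ A)}

open Classical in
/-- The characteristic function modulo 2 of a set of edges. -/
noncomputable def ind {E : Type*} (D : Set E) (e : E) : ZMod 2 := if e ∈ D then 1 else 0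

/-- `x` is even on every finite cut. -/
def CutEven (x : G.edgeSet → ZMod 2) : Prop :=
  ∀ (A : Set V) (h : (cutEdges G A).Finite), ∑ e ∈ h.toFinset, x e = 0

theorem CutEven.add {x y : G.edgeSet → ZMod 2} (hx : CutEven x) (hy : CutEven y) :
    CutEven (x + y) := fun A h => by
  simp only [Pi.add_apply, Finset.sum_add_distrib, hx A h, hy A h, add_zero]

theorem CutEven.listSum {L : List (G.edgeSet → ZMod 2)} (h : ∀ x ∈ L, CutEven x) :
    CutEven L.sum := by
  induction L with
  | nil => intro A h; simp
  | cons x L ih =>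
    rw [List.sum_cons]
    exact (h x (by simp)).add (ih fun y hy => h y (by simp [hy]))

theorem ind_thinSum {E ι : Type*} {F : ι → Set E} (e : E) :
    ind (thinSum F) e = ({i | e ∈ F i}.ncard : ZMod 2) := by
  rw [ind]
  split_ifs with h
  · exact ((ZMod.natCast_eq_one_iff_odd).2 h).symm
  · exact ((ZMod.natCast_eq_zero_iff_even).2 (Nat.not_odd_iff_even.1 h)).symm

/-- By thinness only finitely many members meet a given finite cut, so the sum over the cut and the
sum over the family may be interchanged. -/
theorem CutEven.thinSum {ι : Type*} {F : ι → Set G.edgeSet} (hF : IsThin F)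
    (h : ∀ i, CutEven (ind (F i))) : CutEven (ind (EndGraph.thinSum F)) := by
  classical
  intro A hA
  set K := hA.toFinset with hK
  have hJ : (⋃ e ∈ K, {i | e ∈ F i}).Finite := K.finite_toSet.biUnion fun e _ => hF e
  set J := hJ.toFinset with hJdef
  have hcount : ∀ e ∈ K, (({i | e ∈ F i}.ncard : ℕ) : ZMod 2) = ∑ i ∈ J, ind (F i) e := by
    intro e he
    have : {i | e ∈ F i} = ((J.filter fun i => e ∈ F i : Finset ι) : Set ι) := by
      ext i
      simp only [mem_ofPred_eq, Finset.coe_filter, hJdef, Finite.mem_toFinset, mem_iUnion,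
        exists_prop, iff_and_self]
      exact fun hi => ⟨e, he, hi⟩
    rw [this, ncard_coe_finset]
    simp only [ind, Finset.sum_ite, Finset.sum_const_zero, add_zero, Finset.sum_const,
      nsmul_eq_mul, mul_one]
  simp only [ind_thinSum]
  rw [Finset.sum_congr rfl hcount, Finset.sum_comm]
  exact Finset.sum_eq_zero fun i _ => h i A hA

open Classical in
/-- The weight of `A` at a point: `1` at the vertices of `A` and at the ends in `A`, `0` at the
other vertices and ends, linear on edges. -/
noncomputable def sideFun (A : Set V) : Space G → ℝ
  | .inG p => ∑ᶠ v, A.indicator p.coord v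
  | .atEnd ω => if ∃ R : Ray G, R.toEnd = ω ∧ ∃ N, ∀ n ≥ N, R.vert n ∈ A then 1 else 0

theorem sideFun_eq_finsum (A : Set V) {x : Space G} (hx : ∀ ω, x ≠ .atEnd ω) :
    sideFun A x = ∑ᶠ v, A.indicator (wt x) v := by
  rcases x with p | ω
  · rfl
  · exact absurd rfl (hx ω)

open Classical in
theorem sideFun_vertexPoint (A : Set V) (v : V) :
    sideFun A (vertexPoint G v) = if v ∈ A then 1 else 0 := by
  rw [sideFun_eq_finsum A (by simp), finsum_eq_single _ v fun w hw => by
    simp [indicator, wt_vertexPoint, hw]]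
  simp [indicator, wt_vertexPoint]

open Classical in
theorem sideFun_epoint (A : Set V) (e : G.edgeSet) (t : I) :
    sideFun A (epoint e t) =
      (if src e ∈ A then 1 - (t : ℝ) else 0) + if tgt e ∈ A then (t : ℝ) else 0 := by
  rw [sideFun_eq_finsum A (by simp), finsum_eq_sum_of_support_subset (s := {src e, tgt e}),
    Finset.sum_pair (src_ne_tgt e)]
  · simp [indicator, wt_epoint_src, wt_epoint_tgt]
  · intro v hv
    by_contra hc
    simp only [Finset.coe_insert, Finset.coe_singleton, mem_insert_iff, mem_singleton_iff,
      not_or] at hc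
    refine hv ?_
    simp [indicator, wt_epoint_of_ne t hc.1 hc.2]

theorem JoinedOff.mem_iff {A : Set V} {S : Finset V} (hS : ∀ e ∈ cutEdges G A, src e ∈ S)
    (hS' : ∀ e ∈ cutEdges G A, tgt e ∈ S) {a b : V} (h : JoinedOff G S a b) :
    a ∈ A ↔ b ∈ A := by
  obtain ⟨p, hp⟩ := h
  induction p with
  | nil => rfl
  | @cons a b c hab p ih =>
    rw [← ih fun x hx => hp x (by simp [hx])]
    by_contra hne
    have ha : a ∉ S := hp a (by simp)
    obtain ⟨e, -, ⟨h1, h2, -⟩ | ⟨h1, h2, -⟩⟩ := edge_cases hab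
    · exact ha (h1 ▸ hS e (by rw [cutEdges, mem_ofPred_eq, ← h1, ← h2]; exact hne))
    · exact ha (h2 ▸ hS' e (by rw [cutEdges, mem_ofPred_eq, ← h1, ← h2, iff_comm]; exact hne))

theorem GraphEnd.exists_ray {ω : GraphEnd G} : ∃ R : Ray G, R.toEnd = ω :=
  Quotient.exists_rep ω

theorem toEnd_eq_iff {R L : Ray G} : R.toEnd = L.toEnd ↔
    ∀ S : Finset V, ∃ N, ∀ n ≥ N, ∀ m ≥ N, JoinedOff G S (R.vert n) (L.vert m) :=
  Quotient.eq (r := Ray.setoid G)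

theorem sideFun_atEnd {A : Set V} {S : Finset V} (hS : ∀ e ∈ cutEdges G A, src e ∈ S)
    (hS' : ∀ e ∈ cutEdges G A, tgt e ∈ S) {ω : GraphEnd G} {v : V}
    (hv : v ∈ endComponent G S ω) :
    sideFun A (.atEnd ω) = sideFun A (vertexPoint G v) := by
  obtain ⟨R, hR, N, hN⟩ := hv
  rw [sideFun_vertexPoint, sideFun]
  congr 1
  apply propext
  constructor
  · rintro ⟨L, hL, M, hM⟩
    obtain ⟨K, hK⟩ := toEnd_eq_iff.1 (hL.trans hR.symm) S
    have h1 := hM (max M K) (le_max_left _ _)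
    have h2 := hK (max M K) (le_max_right _ _) (max N K) (le_max_right _ _)
    have h3 := hN (max N K) (le_max_left _ _)
    rw [h3.mem_iff hS hS', ← h2.mem_iff hS hS']
    exact h1
  · intro hv
    exact ⟨R, hR, N, fun n hn => ((hN n hn).mem_iff hS hS').1 hv⟩

theorem exists_endpoints {K : Set G.edgeSet} (hK : K.Finite) :
    ∃ S : Finset V, (∀ e ∈ K, src e ∈ S) ∧ ∀ e ∈ K, tgt e ∈ S := by
  classical
  exact ⟨hK.toFinset.image src ∪ hK.toFinset.image tgt,
    fun e he => Finset.mem_union_left _ (Finset.mem_image_of_mem _ (hK.mem_toFinset.2 he)),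
    fun e he => Finset.mem_union_right _ (Finset.mem_image_of_mem _ (hK.mem_toFinset.2 he))⟩

theorem endComponent_nonempty (S : Finset V) (ω : GraphEnd G) : (endComponent G S ω).Nonempty := by
  obtain ⟨R, rfl⟩ := GraphEnd.exists_ray (ω := ω)
  obtain ⟨N, hN⟩ := R.joinedOff_tail S
  exact ⟨R.vert N, R, rfl, N, fun n hn => hN N le_rfl n hn⟩

theorem joinedOff_of_mem_endComponent {S : Finset V} {ω : GraphEnd G} {v w : V}
    (hv : v ∈ endComponent G S ω) (hw : w ∈ endComponent G S ω) : JoinedOff G S v w := by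
  obtain ⟨R, hR, N, hN⟩ := hv
  obtain ⟨L, hL, M, hM⟩ := hw
  obtain ⟨K, hK⟩ := toEnd_eq_iff.1 (hR.trans hL.symm) S
  exact ((hN (max N K) (le_max_left _ _)).trans (hK _ (le_max_right _ _) (max M K)
    (le_max_right _ _))).trans (hM _ (le_max_left _ _)).symm

theorem self_mem_endComponent_of_ray {S : Finset V} {ω : GraphEnd G} {R : Ray G}
    (h : ∀ n, R.vert n ∈ endComponent G S ω) (n : ℕ) : R.vert n ∈ endComponent G S R.toEnd :=
  ⟨R, rfl, 0, fun m _ => joinedOff_of_mem_endComponent (h n) (h m)⟩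

/-- Once the endvertices of the finitely many cut edges are removed, no component meets both sides,
so the function is constant near every end. -/
theorem continuous_sideFun {A : Set V} (hA : (cutEdges G A).Finite) :
    Continuous (sideFun (G := G) A) := by
  classical
  obtain ⟨S, hS, hS'⟩ := exists_endpoints hA
  refine continuous_of_epoint (fun e => ?_) fun ω => ⟨S, fun x hx => ?_⟩
  · simp only [sideFun_epoint]
    split_ifs <;> fun_prop
  · obtain ⟨v, rfl⟩ | ⟨e, t, rfl⟩ | ⟨η, rfl⟩ := space_cases x
    · refine (sideFun_atEnd hS hS' ?_).symm
      exact hx v (by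
        change wt (vertexPoint G v) v ≠ 0
        simp [wt_vertexPoint])
    · have hx' : ∀ v, wt (epoint e t) v ≠ 0 → v ∈ endComponent G S ω := hx
      by_cases h0 : (t : ℝ) = 0
      · have hs : src e ∈ endComponent G S ω := hx' _ (by rw [wt_epoint_src, h0]; norm_num)
        rw [sideFun_atEnd hS hS' hs, sideFun_epoint, sideFun_vertexPoint, h0]
        simp
      · have ht : tgt e ∈ endComponent G S ω := hx' _ (by rw [wt_epoint_tgt]; exact h0)
        rw [sideFun_atEnd hS hS' ht, sideFun_epoint, sideFun_vertexPoint]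
        have : e ∉ cutEdges G A := fun h => notMem_endComponent (hS' e h) ht
        rw [cutEdges, mem_ofPred_eq, not_not] at this
        simp only [this]
        split_ifs <;> ring
    · obtain ⟨R, rfl, hR⟩ := hx
      rw [sideFun_atEnd hS hS' (hR 0), ← sideFun_atEnd hS hS' (self_mem_endComponent_of_ray hR 0)]

-- Modulo 1 the side function moves only along the cut edges, forwards or backwards according to
-- their orientation. The right-hand side thus has a global real-valued lift, which forces its rise
-- along every closed curve to vanish.
open Classical in
theorem coe_sideFun {A : Set V} (hA : (cutEdges G A).Finite) (x : Space G) :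
    (sideFun A x : UnitAddCircle) =
      ∑ e ∈ hA.toFinset, (if tgt e ∈ A then (1 : ℤ) else -1) • edgeCoord e x := by
  obtain ⟨v, rfl⟩ | ⟨e, t, rfl⟩ | ⟨ω, rfl⟩ := space_cases x
  · simp only [edgeCoord_vertexPoint, smul_zero, Finset.sum_const_zero, sideFun_vertexPoint]
    split_ifs
    · exact AddCircle.coe_period 1
    · rfl
  · by_cases he : e ∈ cutEdges G A
    · rw [Finset.sum_eq_single_of_mem e (hA.mem_toFinset.2 he) fun e' _ hne => by
        rw [edgeCoord_epoint_of_ne hne, smul_zero], edgeCoord_epoint_self, sideFun_epoint]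
      rw [cutEdges, mem_ofPred_eq] at he
      by_cases h : tgt e ∈ A
      · have : src e ∉ A := fun hs => he ⟨fun _ => h, fun _ => hs⟩
        simp [h, this]
      · have : src e ∈ A := by tauto
        simp only [this, h, if_true, if_false, add_zero, neg_smul, one_smul]
        rw [AddCircle.coe_sub, show ((1 : ℝ) : UnitAddCircle) = 0 from AddCircle.coe_period 1,
          zero_sub]
    · rw [Finset.sum_eq_zero fun e' he' => by
        rw [edgeCoord_epoint_of_ne (fun h : e' = e => he (h ▸ hA.mem_toFinset.1 he')), smul_zero],
        sideFun_epoint]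
      rw [cutEdges, mem_ofPred_eq, not_not] at he
      simp only [he]
      split_ifs
      · rw [sub_add_cancel]
        exact AddCircle.coe_period 1
      · simp
  · simp only [edgeCoord_atEnd, smul_zero, Finset.sum_const_zero, sideFun]
    split_ifs
    · exact AddCircle.coe_period 1
    · rfl

theorem ind_edgesIn_range [T2Space (Space G)] {a : ℝ} (ha : 0 < a) {ρ : AddCircle a → Space G}
    (hρ : Continuous ρ) (hinj : Function.Injective ρ) (e : G.edgeSet) {k : ℤ}
    (hk : rise (fun t : ℝ => edgeCoord e (ρ t)) 0 a = k) :
    ind (edgesIn (range ρ)) e = (k : ZMod 2) := by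
  rw [ind]
  split_ifs with h
  · rw [mem_edgesIn_range_iff ha hρ hinj e hk] at h
    exact ((ZMod.intCast_eq_one_iff_odd).2 h).symm
  · rw [mem_edgesIn_range_iff ha hρ hinj e hk, Int.not_odd_iff_even] at h
    exact ((ZMod.intCast_eq_zero_iff_even).2 h).symm

/-- The signed sum of the rises over the cut edges is zero by `coe_sideFun`. Modulo 2 the signs
disappear, and the rise over `e` becomes the indicator of `e` lying in the circle. -/
theorem CutEven.circle [T2Space (Space G)] {C : Set (Space G)} (hC : IsCircle C) :
    CutEven (ind (edgesIn C)) := by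
  classical
  obtain ⟨γ, hγ, rfl⟩ := hC
  set ρ : AddCircle (1 : ℝ) → Space G := γ ∘ AddCircle.homeomorphCircle one_ne_zero with hρdef
  have hr : range γ = range ρ :=
    ((AddCircle.homeomorphCircle one_ne_zero).surjective.range_comp γ).symm
  have hρ : Continuous ρ := hγ.continuous.comp (AddCircle.homeomorphCircle one_ne_zero).continuous
  have hinj : Function.Injective ρ :=
    hγ.injective.comp (AddCircle.homeomorphCircle one_ne_zero).injective
  rw [hr]
  intro A hA
  have hρ' : Continuous fun t : ℝ => ρ t := hρ.comp (AddCircle.continuous_mk' 1)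
  have h01 : ρ ((0 : ℝ) : AddCircle (1 : ℝ)) = ρ ((1 : ℝ) : AddCircle (1 : ℝ)) := by
    rw [AddCircle.coe_period, AddCircle.coe_zero]
  have hcont : ∀ e : G.edgeSet, Continuous fun t : ℝ => edgeCoord e (ρ t) := fun e =>
    (continuous_edgeCoord e).comp' hρ'
  choose k hk using fun e : G.edgeSet => exists_int_rise (hcont e) (s := 0) (t := 1) (by rw [h01])
  have h1 := rise_eq' (f := fun t : ℝ => (sideFun A (ρ t) : UnitAddCircle))
    ((continuous_sideFun hA).comp' hρ') (fun _ => rfl) 0 1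
  simp only [coe_sideFun hA] at h1
  rw [rise_sum _ (f := fun e (t : ℝ) => (if tgt e ∈ A then (1 : ℤ) else -1) • edgeCoord e (ρ t))
    (fun e => (hcont e).zsmul _), h01, sub_self] at h1
  simp only [rise_zsmul (hcont _), hk] at h1
  have h2 : ∑ e ∈ hA.toFinset, (if tgt e ∈ A then (1 : ℤ) else -1) * k e = 0 := by
    exact_mod_cast h1
  have h3 := congrArg (Int.cast : ℤ → ZMod 2) h2
  push_cast at h3
  rw [← h3]
  refine Finset.sum_congr rfl fun e _ => ?_
  rw [ind_edgesIn_range one_pos hρ hinj e (hk e)]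
  have : (-1 : ZMod 2) = 1 := by decide
  split_ifs
  · simp
  · rw [this, one_mul]

end Cuts

/-! ### Components of the complement of a finite set of vertices -/

section Regions

variable {V : Type u} {G : SimpleGraph V}

theorem joinedOff_self {S : Finset V} {v : V} (hv : v ∉ S) : JoinedOff G S v v :=
  ⟨.nil, by simpa using hv⟩

theorem JoinedOff.notMem_left {S : Finset V} {v w : V} (h : JoinedOff G S v w) : v ∉ S := by
  obtain ⟨p, hp⟩ := h
  exact hp v p.start_mem_support

theorem joinedOff_of_adj {S : Finset V} {v w : V} (h : G.Adj v w) (hv : v ∉ S) (hw : w ∉ S) :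
    JoinedOff G S v w :=
  ⟨.cons h .nil, by simp [hv, hw]⟩

/-- The points of the component of `G - S` containing `v`, with its ends. -/
def compRegion (G : SimpleGraph V) (S : Finset V) (v : V) : Set (Space G) :=
  {x | match x with
    | .inG p => ∀ w, p.coord w ≠ 0 → JoinedOff G S v w
    | .atEnd η => ∃ R : Ray G, R.toEnd = η ∧ ∀ n, JoinedOff G S v (R.vert n)}

theorem compRegion_mono {S T : Finset V} (h : S ⊆ T) (v : V) :
    compRegion G T v ⊆ compRegion G S v := by
  rintro (p | η) hx
  · exact fun w hw => (hx w hw).mono h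
  · obtain ⟨R, hR, hn⟩ := hx
    exact ⟨R, hR, fun n => (hn n).mono h⟩

theorem compRegion_subset_of_joinedOff {S : Finset V} {v w : V} (h : JoinedOff G S v w) :
    compRegion G S v ⊆ compRegion G S w := by
  rintro (p | η) hx
  · exact fun x hw => h.symm.trans (hx x hw)
  · obtain ⟨R, hR, hn⟩ := hx
    exact ⟨R, hR, fun n => h.symm.trans (hn n)⟩

theorem mem_endComponent_of_joinedOff {S : Finset V} {ω : GraphEnd G} {v w : V}
    (hv : v ∈ endComponent G S ω) (h : JoinedOff G S v w) : w ∈ endComponent G S ω := by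
  obtain ⟨R, hR, N, hN⟩ := hv
  exact ⟨R, hR, N, fun n hn => h.symm.trans (hN n hn)⟩

theorem compRegion_subset_endRegion {S : Finset V} {ω : GraphEnd G} {v : V}
    (hv : v ∈ endComponent G S ω) : compRegion G S v ⊆ endRegion G S ω := by
  rintro (p | η) hx
  · exact fun w hw => mem_endComponent_of_joinedOff hv (hx w hw)
  · obtain ⟨R, hR, hn⟩ := hx
    exact ⟨R, hR, fun n => mem_endComponent_of_joinedOff hv (hn n)⟩

theorem vertexPoint_mem_compRegion {S : Finset V} {v w : V} (h : JoinedOff G S v w) :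
    vertexPoint G w ∈ compRegion G S v := by
  intro x hx
  have : wt (vertexPoint G w) x ≠ 0 := hx
  classical
  rw [wt_vertexPoint] at this
  have : x = w := by
    by_contra hne
    simp [hne] at this
  rwa [this]

theorem epoint_mem_compRegion {S : Finset V} {v : V} {e : G.edgeSet} (t : I)
    (hs : JoinedOff G S v (src e)) (ht : JoinedOff G S v (tgt e)) :
    epoint e t ∈ compRegion G S v := by
  intro x hx
  have hx' : wt (epoint e t) x ≠ 0 := hx
  by_cases h1 : x = src e
  · rwa [h1]
  by_cases h2 : x = tgt e
  · rwa [h2]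
  exact absurd (wt_epoint_of_ne t h1 h2) hx'

/-- The edges with an endvertex in `S`. -/
def touching (G : SimpleGraph V) (S : Finset V) : Set G.edgeSet := {e | src e ∈ S ∨ tgt e ∈ S}

end Regions

/-! ### Compactness of `|G|` -/

section Compactness

variable {V : Type u} {G : SimpleGraph V}

theorem finite_ball [G.LocallyFinite] (hG : G.Connected) (o : V) (n : ℕ) :
    {v | G.dist o v ≤ n}.Finite := by
  induction n with
  | zero =>
    refine (finite_singleton o).subset fun v hv => ?_
    have : G.dist o v = 0 := Nat.le_zero.1 hv
    exact (hG.dist_eq_zero_iff.1 this).symm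
  | succ n ih =>
    refine (ih.union (ih.biUnion fun v _ => (G.neighborSet v).toFinite)).subset fun v hv => ?_
    by_cases h : G.dist o v ≤ n
    · exact Or.inl h
    · right
      obtain ⟨p, hp⟩ := hG.exists_walk_length_eq_dist v o
      cases p with
      | nil =>
        simp only [SimpleGraph.dist_self] at h
        omega
      | @cons _ w _ hvw p =>
        rw [SimpleGraph.Walk.length_cons] at hp
        have h1 := SimpleGraph.dist_le p
        rw [SimpleGraph.dist_comm] at hp h1
        have hv' : G.dist o v ≤ n + 1 := hv
        exact mem_iUnion₂.2 ⟨w, show G.dist o w ≤ n by omega, hvw.symm⟩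

/-- The ball of radius `n` about `o` in the graph metric. -/
noncomputable def gball [G.LocallyFinite] (hG : G.Connected) (o : V) (n : ℕ) : Finset V :=
  (finite_ball hG o n).toFinset

variable [G.LocallyFinite] {hG : G.Connected} {o : V}

theorem mem_gball {n : ℕ} {v : V} : v ∈ gball hG o n ↔ G.dist o v ≤ n := by
  simp [gball]

theorem gball_mono {m n : ℕ} (h : m ≤ n) : gball hG o m ⊆ gball hG o n := fun v hv => by
  rw [mem_gball] at *
  omega

theorem exists_subset_gball (hG : G.Connected) (o : V) (S : Finset V) :
    ∃ n, S ⊆ gball hG o n := by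
  refine ⟨S.sup (G.dist o), fun v hv => ?_⟩
  rw [mem_gball]
  exact Finset.le_sup (f := G.dist o) hv

/-- The part of a geodesic from `o` to `v` beyond the vertex `w` avoids the smaller balls
about `o`. -/
theorem joinedOff_of_dist_add (hG : G.Connected) (o : V) {n : ℕ} {w v : V} (hw : n < G.dist o w)
    (hv : G.dist o v = G.dist o w + G.dist w v) : JoinedOff G (gball hG o n) w v := by
  classical
  obtain ⟨p, hp⟩ := hG.exists_walk_length_eq_dist w v
  refine ⟨p, fun x hx hxn => ?_⟩
  rw [mem_gball] at hxn
  have h1 := p.take_spec hx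
  have h2 := congrArg SimpleGraph.Walk.length h1
  rw [SimpleGraph.Walk.length_append] at h2
  have h3 := SimpleGraph.dist_le (p.dropUntil x hx)
  have h4 := hG.dist_triangle (u := o) (v := x) (w := v)
  have h5 := SimpleGraph.dist_le (p.takeUntil x hx)
  omega

/-- **König's lemma** for components: a family of properties of the components of the complements
of the balls about `o` that is inherited by the components containing them and is satisfied for
each radius is satisfied by all components of some end. -/
theorem exists_end_of_components {Q : ℕ → V → Prop} (h1 : ∀ n v, Q n v → v ∉ gball hG o n)
    (h2 : ∀ n v w, Q n v → JoinedOff G (gball hG o n) v w → Q n w)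
    (h3 : ∀ n v, Q (n + 1) v → Q n v) (h4 : ∀ n, ∃ v, Q n v) :
    ∃ ω : GraphEnd G, ∀ n, ∀ v ∈ endComponent G (gball hG o n) ω, Q n v := by
  have h3' : ∀ m n v, n ≤ m → Q m v → Q n v := by
    intro m n v hnm h
    induction m, hnm using Nat.le_induction with
    | base => exact h
    | succ m _ ih => exact ih (h3 m v h)
  -- `T n w` says that for every `m` some vertex satisfying `Q m` can be reached from `o` by a
  -- geodesic through `w`, at distance `n`. This is the infinitary condition that local finiteness
  -- passes on to a neighbour.
  let T : ℕ → V → Prop := fun n w => G.dist o w = n ∧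
    ∀ m, ∃ v, Q m v ∧ G.dist o v = n + G.dist w v
  have hT0 : T 0 o := ⟨SimpleGraph.dist_self, fun m => by
    obtain ⟨v, hv⟩ := h4 m
    exact ⟨v, hv, by simp⟩⟩
  have hstep : ∀ n w, T n w → ∃ w', G.Adj w w' ∧ T (n + 1) w' := by
    rintro n w ⟨hw, hm⟩
    by_contra! hcon
    have hbad : ∀ w' : G.neighborSet w, ∃ m, ∀ v, Q m v → G.dist o v ≠ n + 1 + G.dist w' v ∨
        G.dist o w' ≠ n + 1 := by
      intro w'
      have := hcon w' w'.2
      simp only [T, not_and, not_forall, not_exists] at this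
      by_cases hd : G.dist o w' = n + 1
      · obtain ⟨m, hm⟩ := this hd
        exact ⟨m, fun v hv => Or.inl (hm v hv)⟩
      · exact ⟨0, fun v _ => Or.inr hd⟩
    choose m' hm' using hbad
    -- One level beyond the failure levels `m'` of all neighbours: the first step of a geodesic from
    -- `w` to `v` leads to a neighbour that does not fail. Taking the maximum with `n` puts `v`
    -- outside the ball of radius `n`, so that `v ≠ w`.
    obtain ⟨v, hv, hvd⟩ := hm (max n (Finset.univ.sup m'))
    have hvn := h1 _ _ hv
    rw [mem_gball] at hvn
    obtain ⟨p, hp⟩ := hG.exists_walk_length_eq_dist w v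
    cases p with
    | nil =>
      simp only [SimpleGraph.dist_self] at hvd
      have := le_max_left n (Finset.univ.sup m')
      omega
    | @cons _ w' _ hww' p =>
      rw [SimpleGraph.Walk.length_cons] at hp
      have e1 := SimpleGraph.dist_le p
      have e2 := hG.dist_triangle (u := o) (v := w') (w := v)
      have e3 := hG.dist_triangle (u := o) (v := w) (w := w')
      have e4 : G.dist w w' ≤ 1 := by
        simpa using SimpleGraph.dist_le (SimpleGraph.Walk.cons hww' .nil)
      have hle : m' ⟨w', hww'⟩ ≤ max n (Finset.univ.sup m') :=
        le_max_of_le_right (Finset.le_sup (f := m') (Finset.mem_univ (⟨w', hww'⟩ : G.neighborSet w)))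
      have := hm' ⟨w', hww'⟩ v (h3' _ _ v hle hv)
      simp only at this
      omega
  choose next hadj hnext using hstep
  let r : (n : ℕ) → {w // T n w} := fun n =>
    Nat.rec ⟨o, hT0⟩ (fun n w => ⟨next n w.1 w.2, hnext n w.1 w.2⟩) n
  let R : Ray G :=
    { vert := fun n => (r n).1
      inj := fun m n h => by
        have hm := (r m).2.1
        have hn := (r n).2.1
        change (r m).1 = (r n).1 at h
        rw [h] at hm
        exact hm.symm.trans hn
      adj := fun n => hadj n _ (r n).2 }
  refine ⟨R.toEnd, fun n v hv => ?_⟩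
  obtain ⟨L, hL, N, hN⟩ := hv
  obtain ⟨K, hK⟩ := toEnd_eq_iff.1 hL (gball hG o n)
  have e1 := (hN (max N K) (le_max_left _ _)).trans
    (hK _ (le_max_right _ _) (max K (n + 1)) (le_max_left _ _))
  have hT := (r (max K (n + 1))).2
  obtain ⟨v', hv', hd⟩ := hT.2 n
  have e2 := joinedOff_of_dist_add hG o (n := n) (v := v') (by
    rw [hT.1]
    exact lt_of_lt_of_le (Nat.lt_succ_self n) (le_max_right _ _)) (by rw [hT.1]; exact hd)
  exact h2 n v' v hv' (e1.trans e2).symm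

theorem finite_touching (S : Finset V) : (touching G S).Finite := by
  have : (touching G S) ⊆ ⋃ v ∈ S, {e : G.edgeSet | v ∈ (e : Sym2 V)} := by
    rintro e (h | h)
    · exact mem_iUnion₂.2 ⟨_, h, mem_edge_iff.2 (Or.inl rfl)⟩
    · exact mem_iUnion₂.2 ⟨_, h, mem_edge_iff.2 (Or.inr rfl)⟩
  refine (S.finite_toSet.biUnion fun v _ => ?_).subset this
  refine Set.Finite.subset (((G.neighborSet v).toFinite.image fun w => s(v, w)).preimage
    (Subtype.val_injective (p := (· ∈ G.edgeSet))).injOn) fun e he => ?_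
  obtain ⟨w, hw⟩ := Sym2.mem_iff_exists.1 he
  refine ⟨w, ?_, hw.symm⟩
  rw [SimpleGraph.mem_neighborSet, ← SimpleGraph.mem_edgeSet, ← hw]
  exact e.2

/-- Every component outside a ball meets the next sphere, which is finite; so there are only
finitely many such components. -/
theorem exists_joinedOff_sphere {n : ℕ} {v : V} (hv : v ∉ gball hG o n) :
    ∃ w, G.dist o w = n + 1 ∧ JoinedOff G (gball hG o n) w v := by
  induction h : G.dist o v using Nat.strong_induction_on generalizing v with
  | _ m ih =>
    have hn : n < G.dist o v := by
      rw [mem_gball] at hv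
      omega
    by_cases hm : m = n + 1
    · exact ⟨v, h.trans hm, joinedOff_self hv⟩
    · obtain ⟨p, hp⟩ := hG.exists_walk_length_eq_dist v o
      cases p with
      | nil => simp at hn
      | @cons _ w _ hvw p =>
        rw [SimpleGraph.Walk.length_cons] at hp
        have e1 := SimpleGraph.dist_le p
        have e2 := hG.dist_triangle (u := o) (v := w) (w := v)
        have e4 : G.dist w v ≤ 1 := by
          simpa using SimpleGraph.dist_le (SimpleGraph.Walk.cons hvw.symm .nil)
        rw [SimpleGraph.dist_comm] at hp e1
        have hw : w ∉ gball hG o n := by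
          rw [mem_gball]
          omega
        obtain ⟨x, hx, hxw⟩ := ih (G.dist o w) (by omega) hw rfl
        exact ⟨x, hx, hxw.trans (joinedOff_of_adj hvw.symm hw hv)⟩

theorem space_cover (n : ℕ) (x : Space G) :
    (∃ v ∈ gball hG o n, x = vertexPoint G v) ∨
      (∃ e ∈ touching G (gball hG o n), x ∈ range (epoint e)) ∨
      ∃ v ∈ gball hG o (n + 1), v ∉ gball hG o n ∧ x ∈ compRegion G (gball hG o n) v := by
  have hout : ∀ w, w ∉ gball hG o n → ∃ v ∈ gball hG o (n + 1), v ∉ gball hG o n ∧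
      JoinedOff G (gball hG o n) v w := fun w hw => by
    obtain ⟨v, hv, hvw⟩ := exists_joinedOff_sphere hw
    exact ⟨v, mem_gball.2 hv.le, hvw.notMem_left, hvw⟩
  obtain ⟨w, rfl⟩ | ⟨e, t, rfl⟩ | ⟨ω, rfl⟩ := space_cases x
  · by_cases hw : w ∈ gball hG o n
    · exact Or.inl ⟨w, hw, rfl⟩
    · obtain ⟨v, hv, hv', hvw⟩ := hout w hw
      exact Or.inr (Or.inr ⟨v, hv, hv', vertexPoint_mem_compRegion hvw⟩)
  · by_cases he : e ∈ touching G (gball hG o n)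
    · exact Or.inr (Or.inl ⟨e, he, t, rfl⟩)
    · rw [touching, mem_ofPred_eq, not_or] at he
      obtain ⟨v, hv, hv', hvw⟩ := hout _ he.1
      exact Or.inr (Or.inr ⟨v, hv, hv', epoint_mem_compRegion t hvw
        (hvw.trans (joinedOff_of_adj (adj_src_tgt e) he.1 he.2))⟩)
  · right; right
    obtain ⟨R, rfl⟩ := GraphEnd.exists_ray (ω := ω)
    obtain ⟨N, hN⟩ := R.joinedOff_tail (gball hG o n)
    obtain ⟨v, hv, hv', hvw⟩ := hout _ (hN N le_rfl N le_rfl).notMem_left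
    let L : Ray G := ⟨fun m => R.vert (N + m), fun a b h => by
      have := R.inj h
      omega, fun m => R.adj (N + m)⟩
    refine ⟨v, hv, hv', L, ?_, fun m => hvw.trans (hN N le_rfl _ (Nat.le_add_right _ _))⟩
    rw [toEnd_eq_iff]
    intro S
    obtain ⟨M, hM⟩ := R.joinedOff_tail S
    exact ⟨M, fun a ha b hb => hM _ (by omega) _ hb⟩

/-- An ultrafilter containing an edge or a vertex converges, as these are compact. Otherwise, for
each `n`, the finite cover `space_cover` puts the region of some component outside the `n`-ball into
the ultrafilter, and König's lemma turns these components into an end, which is the limit. -/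
theorem compactSpace (hG : G.Connected) : CompactSpace (Space G) := by
  obtain ⟨o⟩ := hG.nonempty
  refine ⟨isCompact_iff_ultrafilter_le_nhds.2 fun 𝒰 _ => ?_⟩
  by_cases hE : ∃ e : G.edgeSet, range (epoint e) ∈ 𝒰
  · obtain ⟨e, he⟩ := hE
    obtain ⟨x, -, hx⟩ := (isCompact_range (continuous_epoint e)).ultrafilter_le_nhds 𝒰
      (Filter.le_principal_iff.2 he)
    exact ⟨x, mem_univ _, hx⟩
  by_cases hV : ∃ v, {vertexPoint G v} ∈ 𝒰
  · obtain ⟨v, hv⟩ := hV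
    obtain ⟨x, -, hx⟩ := (isCompact_singleton (x := vertexPoint G v)).ultrafilter_le_nhds 𝒰
      (Filter.le_principal_iff.2 hv)
    exact ⟨x, mem_univ _, hx⟩
  push Not at hE hV
  obtain ⟨ω, hω⟩ := exists_end_of_components (hG := hG) (o := o)
    (Q := fun n v => v ∉ gball hG o n ∧ compRegion G (gball hG o n) v ∈ 𝒰)
    (fun n v h => h.1)
    (fun n v w h hvw => ⟨hvw.symm.notMem_left,
      Filter.mem_of_superset h.2 (compRegion_subset_of_joinedOff hvw)⟩)
    (fun n v h => ⟨fun hv => h.1 (gball_mono (Nat.le_succ n) hv),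
      Filter.mem_of_superset h.2 (compRegion_mono (gball_mono (Nat.le_succ n)) v)⟩)
    (fun n => by
      have hcov : (⋃ v ∈ (gball hG o n : Set V), {vertexPoint G v}) ∪
          (⋃ e ∈ touching G (gball hG o n), range (epoint e)) ∪
          (⋃ v ∈ {v | v ∈ gball hG o (n + 1) ∧ v ∉ gball hG o n},
            compRegion G (gball hG o n) v) ∈ 𝒰 := by
        refine Filter.mem_of_superset Filter.univ_mem fun x _ => ?_
        rcases space_cover (hG := hG) (o := o) n x with ⟨v, hv, rfl⟩ | ⟨e, he, hx⟩ | ⟨v, hv, hv', hx⟩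
        · exact Or.inl (Or.inl (mem_iUnion₂.2 ⟨v, hv, rfl⟩))
        · exact Or.inl (Or.inr (mem_iUnion₂.2 ⟨e, he, hx⟩))
        · exact Or.inr (mem_iUnion₂.2 ⟨v, ⟨hv, hv'⟩, hx⟩)
      have hfin : {v | v ∈ gball hG o (n + 1) ∧ v ∉ gball hG o n}.Finite :=
        (gball hG o (n + 1)).finite_toSet.subset fun v hv => hv.1
      rw [Ultrafilter.union_mem_iff, Ultrafilter.union_mem_iff,
        Ultrafilter.finite_biUnion_mem_iff (gball hG o n).finite_toSet,
        Ultrafilter.finite_biUnion_mem_iff (finite_touching _),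
        Ultrafilter.finite_biUnion_mem_iff hfin] at hcov
      rcases hcov with (⟨v, -, hv⟩ | ⟨e, -, he⟩) | ⟨v, hv, hv'⟩
      · exact absurd hv (hV v)
      · exact absurd he (hE e)
      · exact ⟨v, hv.2, hv'⟩)
  refine ⟨.atEnd ω, mem_univ _, fun U hU => ?_⟩
  obtain ⟨W, hWU, hW, hωW⟩ := mem_nhds_iff.1 hU
  obtain ⟨S, hS⟩ := hW.2 ω hωW
  obtain ⟨n, hn⟩ := exists_subset_gball hG o S
  obtain ⟨v, hv⟩ := endComponent_nonempty (gball hG o n) ω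
  exact Filter.mem_of_superset (hω n v hv).2 (((compRegion_subset_endRegion hv).trans
    (endRegion_mono G hn ω)).trans (hS.trans hWU))

end Compactness

/-- The components of the complement of a large ball are small. -/
theorem exists_gball_small {V : Type u} {G : SimpleGraph V} [G.LocallyFinite] (hG : G.Connected)
    (o : V) {d : Space G → Space G → ℝ} (hd : ∀ x y z, d x y ≤ d z x + d z y)
    (hball : ∀ (x : Space G) (r : ℝ), 0 < r → {y | d x y < r} ∈ 𝓝 x) {ε : ℝ} (hε : 0 < ε) :
    ∃ n, ∀ m ≥ n, ∀ v ∉ gball hG o m, ∀ x ∈ compRegion G (gball hG o m) v,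
      ∀ y ∈ compRegion G (gball hG o m) v, d x y < ε := by
  by_contra! hcon
  obtain ⟨ω, hω⟩ := exists_end_of_components (hG := hG) (o := o)
    (Q := fun n v => v ∉ gball hG o n ∧ ∃ x ∈ compRegion G (gball hG o n) v,
      ∃ y ∈ compRegion G (gball hG o n) v, ε ≤ d x y)
    (fun n v h => h.1)
    (fun n v w h hvw => ⟨hvw.symm.notMem_left, by
      obtain ⟨x, hx, y, hy, hxy⟩ := h.2
      exact ⟨x, compRegion_subset_of_joinedOff hvw hx, y, compRegion_subset_of_joinedOff hvw hy,
        hxy⟩⟩)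
    (fun n v h => ⟨fun hv => h.1 (gball_mono (Nat.le_succ n) hv), by
      obtain ⟨x, hx, y, hy, hxy⟩ := h.2
      exact ⟨x, compRegion_mono (gball_mono (Nat.le_succ n)) v hx, y,
        compRegion_mono (gball_mono (Nat.le_succ n)) v hy, hxy⟩⟩)
    (fun n => by
      obtain ⟨m, hm, v, hv, x, hx, y, hy, hxy⟩ := hcon n
      exact ⟨v, fun h => hv (gball_mono hm h), x, compRegion_mono (gball_mono hm) v hx, y,
        compRegion_mono (gball_mono hm) v hy, hxy⟩)
  obtain ⟨W, hWU, hW, hωW⟩ := mem_nhds_iff.1 (hball (.atEnd ω) (ε / 2) (by positivity))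
  obtain ⟨S, hS⟩ := hW.2 ω hωW
  obtain ⟨n, hn⟩ := exists_subset_gball hG o S
  obtain ⟨v, hv⟩ := endComponent_nonempty (gball hG o n) ω
  obtain ⟨-, x, hx, y, hy, hxy⟩ := hω n v hv
  have hsub := (compRegion_subset_endRegion hv).trans ((endRegion_mono G hn ω).trans (hS.trans hWU))
  have h1 : d (.atEnd ω) x < ε / 2 := hsub hx
  have h2 : d (.atEnd ω) y < ε / 2 := hsub hy
  have := hd x y (.atEnd ω)
  linarith

/-! ### Lengths -/

section Lengths

theorem isArc_image {Y : Type*} [TopologicalSpace Y] [T2Space Y] {c : ℝ → Y} {s t : ℝ}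
    (hst : s ≤ t) (hc : ContinuousOn c (Icc s t)) (hinj : InjOn c (Icc s t)) :
    IsArc (c s) (c t) (c '' Icc s t) := by
  rcases hst.eq_or_lt with rfl | hlt
  · right
    simp
  left
  have hmem : ∀ r : I, s + r * (t - s) ∈ Icc s t := fun r => by
    have h0 := r.2.1
    have h1 := r.2.2
    constructor <;> nlinarith
  refine ⟨fun r => c (s + r * (t - s)), ?_, by simp, by simp, ?_⟩
  · refine (Continuous.isClosedEmbedding (hc.comp_continuous (by fun_prop) hmem) ?_).isEmbedding
    intro r r' h
    have := hinj (hmem r) (hmem r') h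
    apply Subtype.ext
    have h2 : (r : ℝ) * (t - s) = r' * (t - s) := by linarith
    exact mul_right_cancel₀ (by linarith) h2
  · apply Subset.antisymm
    · rintro _ ⟨r, rfl⟩
      exact mem_image_of_mem c (hmem r)
    · rintro _ ⟨x, hx, rfl⟩
      refine ⟨⟨(x - s) / (t - s), div_nonneg (by linarith [hx.1]) (by linarith),
        (div_le_one (by linarith)).2 (by linarith [hx.2])⟩, ?_⟩
      simp only
      congr 1
      field_simp [(by linarith : t - s ≠ 0)]
      ring

/-- On the line, Lebesgue measure is one-dimensional Hausdorff measure, so no measurability of `s`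
or of its image is needed. -/
theorem volume_image_le_of_lipschitzOn {K : ℝ≥0} {f : ℝ → ℝ} {s : Set ℝ}
    (hf : LipschitzOnWith K f s) : volume (f '' s) ≤ K * volume s := by
  have := hf.hausdorffMeasure_image_le zero_le_one
  rwa [hausdorffMeasure_real, ENNReal.rpow_one] at this

theorem volume_unitInterval (B : Set I) : volume B = volume (Subtype.val '' B : Set ℝ) :=
  (volume_image_subtype_coe measurableSet_Icc B).symm

theorem volume_unitInterval_subsingleton {B : Set I} (hB : B.Subsingleton) : volume B = 0 := by
  rw [volume_unitInterval]
  exact (hB.image _).measure_zero _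

variable {V : Type u} {G : SimpleGraph V} {ℓ : G.edgeSet → ℝ≥0}

theorem length_eq (X : Set (Space G)) :
    length ℓ X = ∑' e : G.edgeSet, (ℓ e : ℝ≥0∞) * volume (epoint e ⁻¹' X) := rfl

theorem mul_volume_le_length (e : G.edgeSet) (X : Set (Space G)) :
    (ℓ e : ℝ≥0∞) * volume (epoint e ⁻¹' X) ≤ length ℓ X :=
  ENNReal.le_tsum (f := fun e : G.edgeSet => (ℓ e : ℝ≥0∞) * volume (epoint e ⁻¹' X)) e

/-- The distance from a point of `e` to the nearer endvertex along `e`; zero off the edge `e`. -/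
noncomputable def sawtooth (ℓ : G.edgeSet → ℝ≥0) (e : G.edgeSet) (x : Space G) : ℝ :=
  ℓ e * min (wt x (src e)) (wt x (tgt e))

theorem continuous_sawtooth (e : G.edgeSet) : Continuous (sawtooth ℓ e) :=
  continuous_const.mul ((continuous_wt _).min (continuous_wt _))

theorem sawtooth_epoint (e : G.edgeSet) (t : I) :
    sawtooth ℓ e (epoint e t) = ℓ e * min (1 - (t : ℝ)) t := by
  rw [sawtooth, wt_epoint_src, wt_epoint_tgt]

theorem wt_nonneg (x : Space G) (v : V) : 0 ≤ wt x v := by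
  classical
  obtain ⟨w, rfl⟩ | ⟨e, t, rfl⟩ | ⟨ω, rfl⟩ := space_cases x
  · rw [wt_vertexPoint]
    split_ifs <;> norm_num
  · rw [epoint, wt_edgePoint]
    have h0 := t.2.1
    have h1 := t.2.2
    split_ifs <;> linarith
  · simp

theorem sawtooth_eq_zero {e : G.edgeSet} {x : Space G} (h : x ∉ range (epoint e)) :
    sawtooth ℓ e x = 0 := by
  classical
  have key : min (wt x (src e)) (wt x (tgt e)) = 0 := by
    have h1 := wt_nonneg x (src e)
    have h2 := wt_nonneg x (tgt e)
    have h3 : wt x (src e) = 0 ∨ wt x (tgt e) = 0 := by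
      obtain ⟨w, rfl⟩ | ⟨e', t, rfl⟩ | ⟨ω, rfl⟩ := space_cases x
      · have := src_ne_tgt e
        simp only [wt_vertexPoint]
        by_cases hw : src e = w
        · right
          rw [if_neg]
          exact fun h => this (hw.trans h.symm)
        · left
          rw [if_neg hw]
      · exact wt_epoint_of_edge_ne (fun he : e = e' => h ⟨t, by rw [he]⟩) t
      · left
        rfl
    rcases h3 with h3 | h3
    · rw [h3]
      exact min_eq_left h2
    · rw [h3]
      exact min_eq_right h1
  rw [sawtooth, key, mul_zero]

theorem exists_of_sawtooth_pos {e : G.edgeSet} {x : Space G} (h : 0 < sawtooth ℓ e x) :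
    ∃ t : I, x = epoint e t ∧ (0 : ℝ) < t ∧ (t : ℝ) < 1 := by
  by_cases hx : x ∈ range (epoint e)
  · obtain ⟨t, rfl⟩ := hx
    rw [sawtooth_epoint] at h
    have := pos_of_mul_pos_right h (ℓ e).2
    rw [lt_min_iff] at this
    exact ⟨t, rfl, this.2, by linarith [this.1]⟩
  · rw [sawtooth_eq_zero hx] at h
    exact absurd h (lt_irrefl _)

theorem eq_of_sawtooth_pos {e e' : G.edgeSet} {x : Space G} (h : 0 < sawtooth ℓ e x)
    (h' : 0 < sawtooth ℓ e' x) : e = e' := by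
  obtain ⟨t, rfl, -⟩ := exists_of_sawtooth_pos h
  by_contra hne
  rw [sawtooth] at h'
  have := pos_of_mul_pos_right h' (ℓ e').2
  rw [lt_min_iff] at this
  rcases wt_epoint_of_edge_ne (Ne.symm hne) t with h0 | h0
  · exact this.1.ne' h0
  · exact this.2.ne' h0

theorem IsArc.isPreconnected {Y : Type*} [TopologicalSpace Y] {x y : Y} {A : Set Y}
    (h : IsArc x y A) : IsPreconnected A ∧ x ∈ A ∧ y ∈ A := by
  rcases h with ⟨γ, hγ, rfl, rfl, rfl⟩ | ⟨rfl, rfl⟩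
  · exact ⟨isPreconnected_range hγ.continuous, mem_range_self _, mem_range_self _⟩
  · exact ⟨isPreconnected_singleton, rfl, rfl⟩

/-- The barycentric coordinate itself is unsuitable, because the endvertices of a long edge may be
close via another route. The sawtooth vanishes off the interior of `e`, so it changes along an arc
only inside `e`: the arc is connected and must cover all intermediate values there, at the cost of
as much length. -/
theorem ofReal_abs_sawtooth_sub_le (e : G.edgeSet) (x y : Space G) :
    ENNReal.ofReal |sawtooth ℓ e x - sawtooth ℓ e y| ≤ arcDist ℓ x y := by
  refine le_iInf₂ fun A hA => ?_
  obtain ⟨hpre, hx, hy⟩ := hA.isPreconnected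
  have hconn := hpre.image _ (continuous_sawtooth (ℓ := ℓ) e).continuousOn
  have hsub : uIcc (sawtooth ℓ e y) (sawtooth ℓ e x) ⊆ sawtooth ℓ e '' A :=
    hconn.ordConnected.uIcc_subset (mem_image_of_mem _ hy) (mem_image_of_mem _ hx)
  set h : ℝ → ℝ := fun t => ℓ e * min (1 - t) t with hh
  have hlip : LipschitzWith (ℓ e) h := by
    refine LipschitzWith.of_dist_le_mul fun s t => ?_
    rw [Real.dist_eq, Real.dist_eq, hh]
    simp only
    rw [← mul_sub, abs_mul, abs_of_nonneg (ℓ e).coe_nonneg]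
    refine mul_le_mul_of_nonneg_left ((abs_min_sub_min_le_max _ _ _ _).trans ?_) (ℓ e).2
    refine max_le (le_of_eq ?_) le_rfl
    rw [abs_sub_comm]
    congr 1
    ring
  have hsub2 : sawtooth ℓ e '' A ⊆ {0} ∪ h '' (Subtype.val '' (epoint e ⁻¹' A)) := by
    rintro _ ⟨z, hz, rfl⟩
    by_cases hzr : z ∈ range (epoint e)
    · obtain ⟨t, rfl⟩ := hzr
      exact Or.inr ⟨t, ⟨t, hz, rfl⟩, (sawtooth_epoint e t).symm⟩
    · exact Or.inl (sawtooth_eq_zero hzr)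
  calc ENNReal.ofReal |sawtooth ℓ e x - sawtooth ℓ e y|
      = volume (uIcc (sawtooth ℓ e y) (sawtooth ℓ e x)) := by rw [Real.volume_interval]
    _ ≤ volume ({0} ∪ h '' (Subtype.val '' (epoint e ⁻¹' A))) := measure_mono (hsub.trans hsub2)
    _ ≤ volume {(0 : ℝ)} + volume (h '' (Subtype.val '' (epoint e ⁻¹' A))) := measure_union_le _ _
    _ ≤ 0 + ℓ e * volume (Subtype.val '' (epoint e ⁻¹' A) : Set ℝ) := by
        gcongr
        · simp
        · exact volume_image_le_of_lipschitzOn hlip.lipschitzOnWith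
    _ = ℓ e * volume (epoint e ⁻¹' A) := by rw [zero_add, volume_unitInterval]
    _ ≤ length ℓ A := mul_volume_le_length e A

theorem length_edge_segment_le (e : G.edgeSet) {s t : ℝ} (hs : 0 ≤ s) (ht : t ≤ 1) :
    length ℓ ((fun r => epoint e (projIcc 0 1 zero_le_one r)) '' Icc s t) ≤
      ENNReal.ofReal (ℓ e * (t - s)) := by
  rw [length_eq, tsum_eq_single e]
  · rw [ENNReal.ofReal_mul (ℓ e).coe_nonneg, ENNReal.ofReal_coe_nnreal, ← Real.volume_Icc,
      volume_unitInterval]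
    gcongr
    rintro _ ⟨r, ⟨r', hr', h⟩, rfl⟩
    have := epoint_injective e h
    rw [projIcc_of_mem zero_le_one ⟨hs.trans hr'.1, hr'.2.trans ht⟩] at this
    rwa [← this]
  · intro e' hne
    have hsub : epoint e' ⁻¹' ((fun r => epoint e (projIcc 0 1 zero_le_one r)) '' Icc s t) ⊆
        {0} ∪ {1} := by
      rintro r ⟨r', -, h⟩
      by_contra hc
      simp only [mem_union, mem_singleton_iff, not_or] at hc
      have h1 := congrArg (edgeCoord e') h
      simp only at h1
      rw [edgeCoord_epoint_of_ne hne, edgeCoord_epoint_self] at h1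
      refine coe_ne_zero_of_mem_Ioo ⟨?_, ?_⟩ h1.symm
      · exact lt_of_le_of_ne r.2.1 fun h => hc.1 (Subtype.ext h.symm)
      · exact lt_of_le_of_ne r.2.2 fun h => hc.2 (Subtype.ext h)
    have : volume (epoint e' ⁻¹' ((fun r => epoint e (projIcc 0 1 zero_le_one r)) '' Icc s t)) = 0 :=
      measure_mono_null hsub (measure_union_null
        (volume_unitInterval_subsingleton subsingleton_singleton)
        (volume_unitInterval_subsingleton subsingleton_singleton))
    rw [this, mul_zero]

instance : MeasurableSpace (Space G) := borel _

instance : BorelSpace (Space G) := ⟨rfl⟩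

/-- The length as a Borel measure. -/
noncomputable def lengthMeasure (ℓ : G.edgeSet → ℝ≥0) : Measure (Space G) :=
  Measure.sum fun e => (ℓ e : ℝ≥0∞) • (volume : Measure I).map (epoint e)

theorem lengthMeasure_apply {B : Set (Space G)} (hB : MeasurableSet B) :
    lengthMeasure ℓ B = length ℓ B := by
  rw [lengthMeasure, Measure.sum_apply _ hB, length_eq]
  refine tsum_congr fun e => ?_
  rw [Measure.smul_apply, Measure.map_apply (continuous_epoint e).measurable hB, smul_eq_mul]

theorem length_singleton (x : Space G) : length ℓ {x} = 0 := by
  rw [length_eq, ENNReal.tsum_eq_zero]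
  intro e
  rw [volume_unitInterval_subsingleton, mul_zero]
  exact fun s hs t ht => epoint_injective e (hs.trans ht.symm)

/-- The arc length along an arc of finite length is continuous. -/
theorem exists_arc_length_function [T2Space (Space G)] {γ : I → Space G} (hγ : IsEmbedding γ)
    (hfin : length ℓ (range γ) ≠ ∞) :
    ∃ g : ℝ → ℝ, Continuous g ∧ g 1 - g 0 = (length ℓ (range γ)).toReal ∧
      ∀ s t, 0 ≤ s → s ≤ t → t ≤ 1 → arcDist ℓ (γ (projIcc 0 1 zero_le_one s))
        (γ (projIcc 0 1 zero_le_one t)) ≤ ENNReal.ofReal (g t - g s) := by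
  have hcl : IsClosedEmbedding γ := hγ.continuous.isClosedEmbedding hγ.injective
  have hme := hcl.measurableEmbedding
  -- Length along the arc as a measure on the parameter interval. It is finite and has no atoms, so
  -- its distribution function is continuous.
  set ν : Measure ℝ := ((lengthMeasure ℓ).comap γ).map Subtype.val with hν
  have hνapply : ∀ B : Set ℝ, MeasurableSet B → ν B = lengthMeasure ℓ (γ '' (Subtype.val ⁻¹' B)) :=
    fun B hB => by
      rw [hν, Measure.map_apply measurable_subtype_coe hB, hme.comap_apply]
  have hνuniv : ν univ = length ℓ (range γ) := by
    rw [hνapply _ MeasurableSet.univ, preimage_univ, image_univ,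
      lengthMeasure_apply hcl.isClosed_range.measurableSet]
  have : IsFiniteMeasure ν := ⟨by rw [hνuniv]; exact hfin.lt_top⟩
  have hsing : ∀ x, ν {x} = 0 := fun x => by
    rw [hνapply _ (measurableSet_singleton x)]
    by_cases hx : x ∈ Icc (0 : ℝ) 1
    · rw [show (Subtype.val ⁻¹' {x} : Set I) = {⟨x, hx⟩} by
        ext y; simp [Subtype.ext_iff], image_singleton,
        lengthMeasure_apply (measurableSet_singleton _), length_singleton]
    · rw [show (Subtype.val ⁻¹' {x} : Set I) = ∅ by
        ext y
        simp only [mem_preimage, mem_singleton_iff, mem_empty_iff_false, iff_false]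
        rintro rfl
        exact hx y.2, image_empty, measure_empty]
  have : NullSingletonClass ν := ⟨hsing⟩
  have hint : ∀ a b, IntervalIntegrable (fun _ => (1 : ℝ)) ν a b := fun a b =>
    intervalIntegrable_const
  have hdiff : ∀ s t, s ≤ t → (∫ _ in (0 : ℝ)..t, (1 : ℝ) ∂ν) - ∫ _ in (0 : ℝ)..s, (1 : ℝ) ∂ν
      = (ν (Icc s t)).toReal := fun s t hst => by
    rw [intervalIntegral.integral_interval_sub_left (hint _ _) (hint _ _),
      intervalIntegral.integral_const', Ioc_eq_empty (not_lt.2 hst), measureReal_empty, sub_zero,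
      smul_eq_mul, mul_one, measureReal_def, Ioc_ae_eq_Icc.measure_eq]
  refine ⟨fun t => ∫ _ in (0 : ℝ)..t, (1 : ℝ) ∂ν, intervalIntegral.continuous_primitive hint 0,
    ?_, ?_⟩
  · rw [hdiff 0 1 zero_le_one, hνapply _ measurableSet_Icc, Subtype.coe_preimage_self, image_univ,
      lengthMeasure_apply hcl.isClosed_range.measurableSet]
  · intro s t hs hst ht
    simp only
    rw [hdiff s t hst, ENNReal.ofReal_toReal (measure_ne_top _ _), hνapply _ measurableSet_Icc]
    have himg : γ '' (Subtype.val ⁻¹' Icc s t) =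
        (fun r => γ (projIcc 0 1 zero_le_one r)) '' Icc s t := by
      apply Subset.antisymm
      · rintro _ ⟨r, hr, rfl⟩
        exact ⟨r, hr, by simp only [projIcc_val]⟩
      · rintro _ ⟨r, hr, rfl⟩
        refine ⟨_, ?_, rfl⟩
        rw [projIcc_of_mem zero_le_one ⟨hs.trans hr.1, hr.2.trans ht⟩]
        exact hr
    rw [himg, lengthMeasure_apply]
    · refine iInf₂_le _ (isArc_image (c := fun r => γ (projIcc 0 1 zero_le_one r)) hst ?_ ?_)
      · exact (hγ.continuous.comp continuous_projIcc).continuousOn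
      · intro r hr r' hr' h
        have := hγ.injective h
        rw [projIcc_of_mem zero_le_one ⟨hs.trans hr.1, hr.2.trans ht⟩,
          projIcc_of_mem zero_le_one ⟨hs.trans hr'.1, hr'.2.trans ht⟩] at this
        exact congrArg Subtype.val this
    · exact (isCompact_Icc.image (hγ.continuous.comp continuous_projIcc)).isClosed.measurableSet

end Lengths

/-! ### Metric representations -/

section Representation

variable {V : Type u} {G : SimpleGraph V} {ℓ : G.edgeSet → ℝ≥0} {X : Type*} [MetricSpace X]

/-- `X` is a metric copy of `|G|` with the metric `d_ℓ`. -/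
def Represents (ℓ : G.edgeSet → ℝ≥0) (Φ : X ≃ₜ Space G) : Prop :=
  ∀ x y : X, arcDist ℓ (Φ x) (Φ y) = ENNReal.ofReal (dist x y)

variable {Φ : X ≃ₜ Space G}

theorem t2Space_of_homeomorph (Φ : X ≃ₜ Space G) : T2Space (Space G) := Φ.t2Space

theorem Represents.abs_sawtooth_sub_le (hΦ : Represents ℓ Φ) (e : G.edgeSet) (x y : X) :
    |sawtooth ℓ e (Φ x) - sawtooth ℓ e (Φ y)| ≤ dist x y := by
  have := ofReal_abs_sawtooth_sub_le (ℓ := ℓ) e (Φ x) (Φ y)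
  rw [hΦ] at this
  exact (ENNReal.ofReal_le_ofReal_iff dist_nonneg).1 this

theorem Represents.dist_le (hΦ : Represents ℓ Φ) {x y : X} {r : ℝ} (hr : 0 ≤ r)
    (h : arcDist ℓ (Φ x) (Φ y) ≤ ENNReal.ofReal r) : dist x y ≤ r := by
  rw [hΦ] at h
  exact (ENNReal.ofReal_le_ofReal_iff hr).1 h

/-- A nearly shortest arc, reparametrised by arc length, is a 1-Lipschitz curve. -/
theorem Represents.isLengthSpace (hΦ : Represents ℓ Φ) : IsLengthSpace X := by
  have := t2Space_of_homeomorph Φ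
  intro x y r hr
  have hr0 : 0 < r := dist_nonneg.trans_lt hr
  have h1 : arcDist ℓ (Φ x) (Φ y) < ENNReal.ofReal r := by
    rw [hΦ]
    exact (ENNReal.ofReal_lt_ofReal_iff hr0).2 hr
  obtain ⟨A, hA⟩ := iInf_lt_iff.1 h1
  obtain ⟨hA, hAr⟩ := iInf_lt_iff.1 hA
  rcases hA with ⟨γ, hγ, h0, h1, rfl⟩ | ⟨hxy, -⟩
  swap
  · refine ⟨0, hr0, le_rfl, fun _ => x, LipschitzWith.const' x, rfl, Φ.injective hxy⟩
  obtain ⟨g, hg, hglen, hgd⟩ := exists_arc_length_function hγ (hAr.trans ENNReal.ofReal_lt_top).ne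
  set b := g 1 - g 0 with hb
  have hbr : b < r := by
    rw [hglen]
    exact ENNReal.toReal_lt_of_lt_ofReal hAr
  have hb0 : 0 ≤ b := by
    rw [hglen]
    exact ENNReal.toReal_nonneg
  have hmono : ∀ s t, 0 ≤ s → s ≤ t → t ≤ 1 → dist (Φ.symm (γ (projIcc 0 1 zero_le_one s)))
      (Φ.symm (γ (projIcc 0 1 zero_le_one t))) ≤ max (g t - g s) 0 := fun s t hs hst ht => by
    refine hΦ.dist_le (le_max_right _ _) ?_
    simp only [Homeomorph.apply_symm_apply]
    exact (hgd s t hs hst ht).trans (ENNReal.ofReal_le_ofReal (le_max_left _ _))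
  have hdist : ∀ s ∈ Icc (0 : ℝ) 1, ∀ t ∈ Icc (0 : ℝ) 1,
      dist (Φ.symm (γ (projIcc 0 1 zero_le_one s))) (Φ.symm (γ (projIcc 0 1 zero_le_one t)))
        ≤ |g t - g s| := fun s hs t ht => by
    rcases le_total s t with hst | hst
    · exact (hmono s t hs.1 hst ht.2).trans (max_le (le_abs_self _) (abs_nonneg _))
    · rw [dist_comm, abs_sub_comm]
      exact (hmono t s ht.1 hst hs.2).trans (max_le (le_abs_self _) (abs_nonneg _))
  have hex : ∀ ρ : Icc 0 b, ∃ t ∈ Icc (0 : ℝ) 1, g t - g 0 = ρ := fun ρ => by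
    obtain ⟨t, ht, h⟩ := intermediate_value_Icc zero_le_one hg.continuousOn
      (show (ρ : ℝ) + g 0 ∈ Icc (g 0) (g 1) from
        ⟨by linarith [ρ.2.1], by linarith [ρ.2.2]⟩)
    exact ⟨t, ht, by linarith⟩
  -- An arbitrary right inverse of the arc length suffices, even a discontinuous one: distances
  -- along the arc are bounded by differences of `g`, so the composite is still 1-Lipschitz.
  choose τ hτ hgτ using hex
  refine ⟨b, hbr, hb0, fun r => Φ.symm (γ (projIcc 0 1 zero_le_one (τ (projIcc 0 b hb0 r)))),
    ?_, ?_, ?_⟩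
  · refine LipschitzWith.of_dist_le_mul fun s t => ?_
    refine (hdist _ (hτ _) _ (hτ _)).trans ?_
    rw [show g (τ (projIcc 0 b hb0 t)) - g (τ (projIcc 0 b hb0 s)) =
      (projIcc 0 b hb0 t : ℝ) - projIcc 0 b hb0 s by rw [← hgτ, ← hgτ]; ring, NNReal.coe_one,
      one_mul, abs_sub_comm, Real.dist_eq]
    exact abs_projIcc_sub_projIcc hb0
  · have h := hdist _ (hτ (projIcc 0 b hb0 0)) 0 (by simp)
    have h2 := hgτ (projIcc 0 b hb0 0)
    simp only [projIcc_left] at h h2 ⊢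
    rw [show g 0 - g (τ ⟨0, _⟩) = 0 by linarith, abs_zero] at h
    rw [dist_le_zero.1 h, Φ.symm_apply_eq]
    exact h0
  · have h := hdist _ (hτ (projIcc 0 b hb0 b)) 1 (by simp)
    have h2 := hgτ (projIcc 0 b hb0 b)
    simp only [projIcc_right] at h h2 ⊢
    rw [show g 1 - g (τ ⟨b, _⟩) = 0 by linarith, abs_zero] at h
    rw [dist_le_zero.1 h, Φ.symm_apply_eq]
    exact h1

/-- A 1-Lipschitz curve has length at most that of its parameter interval. -/
theorem Represents.length_image_le (hΦ : Represents ℓ Φ) (hℓ : ∀ e, 0 < ℓ e) {c : ℝ → X}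
    (hc : LipschitzWith 1 c) (s t : ℝ) :
    length ℓ ((fun τ => Φ (c τ)) '' Icc s t) ≤ ENNReal.ofReal (t - s) := by
  have hcont : Continuous fun τ => Φ (c τ) := Φ.continuous.comp hc.continuous
  -- The times spent in the interior of `e`. These sets are disjoint for distinct edges, so it is
  -- enough to bound the length covered in each edge by the time spent there.
  set B : G.edgeSet → Set ℝ := fun e => {τ | τ ∈ Icc s t ∧ 0 < sawtooth ℓ e (Φ (c τ))} with hB
  have hBm : ∀ e, MeasurableSet (B e) := fun e => measurableSet_Icc.inter
    (isOpen_lt continuous_const ((continuous_sawtooth e).comp hcont)).measurableSet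
  have hBd : Pairwise (Function.onFun Disjoint B) := fun e e' hne =>
    disjoint_left.2 fun τ h h' => hne (eq_of_sawtooth_pos h.2 h'.2)
  have key : ∀ e : G.edgeSet, (ℓ e : ℝ≥0∞) * volume (epoint e ⁻¹' ((fun τ => Φ (c τ)) '' Icc s t))
      ≤ volume (B e) := by
    intro e
    set w : ℝ → ℝ := fun τ => wt (Φ (c τ)) (tgt e) with hw
    have hwc : Continuous w := (continuous_wt _).comp hcont
    -- On each half of the edge the sawtooth is, up to sign and a constant, `ℓ e` times the
    -- parameter. Since it is 1-Lipschitz along the curve, the parameter is `(ℓ e)⁻¹`-Lipschitz on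
    -- each half.
    set B0 := B e ∩ {τ | w τ < 1 / 2}
    set B1 := B e ∩ {τ | 1 / 2 < w τ}
    have hpt : ∀ τ ∈ B e, sawtooth ℓ e (Φ (c τ)) = ℓ e * min (1 - w τ) (w τ) := fun τ hτ => by
      obtain ⟨r, hr, -⟩ := exists_of_sawtooth_pos hτ.2
      rw [hw]
      simp only
      rw [hr, sawtooth_epoint, wt_epoint_tgt]
    have hsaw : ∀ τ τ', |sawtooth ℓ e (Φ (c τ)) - sawtooth ℓ e (Φ (c τ'))| ≤ |τ - τ'| :=
      fun τ τ' => (hΦ.abs_sawtooth_sub_le e _ _).trans (by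
        simpa [Real.dist_eq] using hc.dist_le_mul τ τ')
    have hℓe : (0 : ℝ) < ℓ e := hℓ e
    have hlip : ∀ S : Set ℝ, (∀ τ ∈ S, ∀ τ' ∈ S, (ℓ e : ℝ) * |w τ - w τ'| =
        |sawtooth ℓ e (Φ (c τ)) - sawtooth ℓ e (Φ (c τ'))|) → (ℓ e : ℝ≥0∞) * volume (w '' S)
          ≤ volume S := by
      intro S hS
      have hL : LipschitzOnWith (ℓ e)⁻¹ w S := LipschitzOnWith.of_dist_le_mul fun τ hτ τ' hτ' => by
        rw [NNReal.coe_inv, Real.dist_eq, Real.dist_eq, inv_mul_eq_div, le_div_iff₀ hℓe, mul_comm,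
          hS τ hτ τ' hτ']
        exact hsaw τ τ'
      calc (ℓ e : ℝ≥0∞) * volume (w '' S) ≤ ℓ e * (((ℓ e)⁻¹ : ℝ≥0) * volume S) := by
            gcongr
            exact volume_image_le_of_lipschitzOn hL
        _ = volume S := by
            rw [← mul_assoc, ← ENNReal.coe_mul, mul_inv_cancel₀ (hℓ e).ne', ENNReal.coe_one,
              one_mul]
    have h0 := hlip B0 fun τ hτ τ' hτ' => by
      have e1 : w τ < 1 / 2 := hτ.2
      have e2 : w τ' < 1 / 2 := hτ'.2
      rw [hpt τ hτ.1, hpt τ' hτ'.1, min_eq_right (by linarith), min_eq_right (by linarith),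
        ← mul_sub, abs_mul, abs_of_pos hℓe]
    have h1 := hlip B1 fun τ hτ τ' hτ' => by
      have e1 : 1 / 2 < w τ := hτ.2
      have e2 : 1 / 2 < w τ' := hτ'.2
      rw [hpt τ hτ.1, hpt τ' hτ'.1, min_eq_left (by linarith), min_eq_left (by linarith),
        ← mul_sub, abs_mul, abs_of_pos hℓe, ← abs_neg]
      congr 2
      ring
    have hsub : (Subtype.val '' (epoint e ⁻¹' ((fun τ => Φ (c τ)) '' Icc s t)) : Set ℝ) ⊆
        {0, 1 / 2, 1} ∪ (w '' B0 ∪ w '' B1) := by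
      rintro _ ⟨r, ⟨τ, hτ, hr⟩, rfl⟩
      by_cases hr3 : (r : ℝ) ∈ ({0, 1 / 2, 1} : Set ℝ)
      · exact Or.inl hr3
      right
      simp only [mem_insert_iff, mem_singleton_iff, not_or] at hr3
      have hr0 : (0 : ℝ) < r := lt_of_le_of_ne r.2.1 (Ne.symm hr3.1)
      have hr1 : (r : ℝ) < 1 := lt_of_le_of_ne r.2.2 hr3.2.2
      simp only at hr
      have hτB : τ ∈ B e := ⟨hτ, by
        rw [hr, sawtooth_epoint]
        exact mul_pos hℓe (lt_min (by linarith) hr0)⟩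
      have hwτ : w τ = r := by
        rw [hw]
        simp only
        rw [hr, wt_epoint_tgt]
      rcases lt_or_gt_of_ne hr3.2.1 with h | h
      · exact Or.inl ⟨τ, ⟨hτB, by rw [mem_ofPred_eq, hwτ]; exact h⟩, hwτ⟩
      · exact Or.inr ⟨τ, ⟨hτB, by rw [mem_ofPred_eq, hwτ]; exact h⟩, hwτ⟩
    have hnull : volume ({0, 1 / 2, 1} : Set ℝ) = 0 :=
      (Set.toFinite ({0, 1 / 2, 1} : Set ℝ)).measure_zero _
    calc (ℓ e : ℝ≥0∞) * volume (epoint e ⁻¹' ((fun τ => Φ (c τ)) '' Icc s t))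
        ≤ ℓ e * (volume ({0, 1 / 2, 1} : Set ℝ) + (volume (w '' B0) + volume (w '' B1))) := by
          rw [volume_unitInterval]
          gcongr
          exact (measure_mono hsub).trans ((measure_union_le _ _).trans (by
            gcongr
            exact measure_union_le _ _))
      _ = ℓ e * volume (w '' B0) + ℓ e * volume (w '' B1) := by rw [hnull, zero_add, mul_add]
      _ ≤ volume B0 + volume B1 := add_le_add h0 h1
      _ = volume (B0 ∪ B1) := by
          refine (measure_union ?_ ((hBm e).inter
            (isOpen_lt continuous_const hwc).measurableSet)).symm
          exact disjoint_left.2 fun τ h h' => lt_asymm (show w τ < 1 / 2 from h.2) h'.2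
      _ ≤ volume (B e) := measure_mono (union_subset inter_subset_left inter_subset_left)
  rw [length_eq, ← Real.volume_Icc]
  calc _ ≤ ∑' e, volume (B e) := ENNReal.tsum_le_tsum key
    _ ≤ volume (⋃ e, B e) := tsum_meas_le_meas_iUnion_of_disjoint _ hBm hBd
    _ ≤ volume (Icc s t) := measure_mono (iUnion_subset fun e τ hτ => hτ.1)

/-- An edge as a 1-Lipschitz curve. -/
theorem Represents.lipschitzWith_edge_curve (hΦ : Represents ℓ Φ) (hℓ : ∀ e, 0 < ℓ e) (e : G.edgeSet) :
    LipschitzWith 1 fun τ : ℝ => Φ.symm (epoint e (projIcc 0 1 zero_le_one (τ / ℓ e))) := by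
  have := t2Space_of_homeomorph Φ
  have hℓe : (0 : ℝ) < ℓ e := hℓ e
  have hmono : ∀ s t : ℝ, 0 ≤ s → s ≤ t → t ≤ 1 →
      dist (Φ.symm (epoint e (projIcc 0 1 zero_le_one s)))
        (Φ.symm (epoint e (projIcc 0 1 zero_le_one t))) ≤ ℓ e * (t - s) := by
    intro s t hs hst ht
    refine hΦ.dist_le (mul_nonneg hℓe.le (by linarith)) ?_
    simp only [Homeomorph.apply_symm_apply]
    refine le_trans (iInf₂_le _ (isArc_image (c := fun r => epoint e (projIcc 0 1 zero_le_one r))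
      hst ?_ ?_)) (length_edge_segment_le e hs ht)
    · exact ((continuous_epoint e).comp continuous_projIcc).continuousOn
    · intro r hr r' hr' h
      have := epoint_injective e h
      rw [projIcc_of_mem zero_le_one ⟨hs.trans hr.1, hr.2.trans ht⟩,
        projIcc_of_mem zero_le_one ⟨hs.trans hr'.1, hr'.2.trans ht⟩] at this
      exact congrArg Subtype.val this
  have hI : ∀ s t : I, dist (Φ.symm (epoint e s)) (Φ.symm (epoint e t)) ≤
      ℓ e * |(s : ℝ) - t| := by
    intro s t
    wlog hst : s ≤ t generalizing s t
    · rw [dist_comm, abs_sub_comm]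
      exact this t s (le_of_not_ge hst)
    have := hmono s t s.2.1 hst t.2.2
    rw [projIcc_val, projIcc_val] at this
    rwa [abs_sub_comm, abs_of_nonneg (sub_nonneg.2 (show (s : ℝ) ≤ t from hst))]
  refine LipschitzWith.of_dist_le_mul fun s t => (hI _ _).trans ?_
  rw [NNReal.coe_one, one_mul, Real.dist_eq]
  refine (mul_le_mul_of_nonneg_left (abs_projIcc_sub_projIcc zero_le_one) hℓe.le).trans (le_of_eq ?_)
  rw [← sub_div, abs_div, abs_of_pos hℓe, mul_div_cancel₀ _ hℓe.ne']

/-- An isometric circle is geodetic. -/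
theorem Represents.isGeodeticCircle (hΦ : Represents ℓ Φ) (hℓ : ∀ e, 0 < ℓ e) {b : ℝ} (hb : 0 < b)
    {c : AddCircle b → X} (hc : Isometry c) : IsGeodeticCircle ℓ (range fun p => Φ (c p)) := by
  have := t2Space_of_homeomorph Φ
  have : Fact (0 < b) := ⟨hb⟩
  constructor
  · refine ⟨fun z => Φ (c ((AddCircle.homeomorphCircle hb.ne').symm z)), ?_, ?_⟩
    · exact Φ.isEmbedding.comp
        (hc.isEmbedding.comp (AddCircle.homeomorphCircle hb.ne').symm.isEmbedding)
    · exact (AddCircle.homeomorphCircle hb.ne').symm.surjective.range_comp fun p => Φ (c p)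
  rintro _ ⟨p, rfl⟩ _ ⟨q, rfl⟩
  -- The representative of `q - p` of least absolute value selects the shorter of the two arcs. Its
  -- length is at most `|r|`, which is the distance in the circle and hence in `X`.
  obtain ⟨r, hr, hrq⟩ : ∃ r : ℝ, r ∈ Ico (-(b / 2)) (-(b / 2) + b) ∧ (r : AddCircle b) = q - p := by
    have := (AddCircle.coe_image_Ico_eq b (-(b / 2))).symm ▸ mem_univ (q - p)
    exact this
  obtain ⟨k, hk, hkr⟩ : ∃ k : ℝ, (|k| = 1) ∧ k * |r| = r := by
    rcases le_total 0 r with h | h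
    · exact ⟨1, by simp, by rw [abs_of_nonneg h, one_mul]⟩
    · exact ⟨-1, by simp, by rw [abs_of_nonpos h]; ring⟩
  have hrb : |r| ≤ b / 2 := abs_le.2 ⟨hr.1, by linarith [hr.2]⟩
  set f : ℝ → X := fun τ => c (p + ((k * τ : ℝ) : AddCircle b)) with hf
  have hfd : ∀ s t, dist (f s) (f t) = ‖((k * (s - t) : ℝ) : AddCircle b)‖ := fun s t => by
    rw [hf]
    simp only
    rw [hc.dist_eq, dist_add_left, dist_eq_norm, ← AddCircle.coe_sub, mul_sub]
  have hfd' : ∀ s t, |s - t| ≤ b / 2 → dist (f s) (f t) = |s - t| := fun s t hst => by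
    rw [hfd, (AddCircle.norm_coe_eq_abs_iff b hb.ne').2, abs_mul, hk, one_mul]
    rwa [abs_mul, hk, one_mul, abs_of_pos hb]
  have hlip : LipschitzWith 1 f := LipschitzWith.of_dist_le_mul fun s t => by
    rw [hfd, NNReal.coe_one, one_mul, Real.dist_eq]
    refine QuotientAddGroup.norm_mk_le_norm.trans (le_of_eq ?_)
    rw [Real.norm_eq_abs, abs_mul, hk, one_mul]
  have h0 : f 0 = c p := by simp [hf]
  have h1 : f |r| = c q := by
    rw [hf]
    simp only
    rw [hkr, hrq, add_sub_cancel]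
  have hIcc : ∀ s ∈ Icc 0 |r|, ∀ t ∈ Icc 0 |r|, |s - t| ≤ b / 2 := fun s hs t ht =>
    (abs_sub_le_of_nonneg_of_le hs.1 hs.2 ht.1 ht.2).trans hrb
  have harc := isArc_image (c := fun τ => Φ (f τ)) (abs_nonneg r)
    (Φ.continuous.comp hlip.continuous).continuousOn (fun s hs t ht h => by
      have h2 := hfd' s t (hIcc s hs t ht)
      rw [Φ.injective h, dist_self] at h2
      exact sub_eq_zero.1 (abs_eq_zero.1 h2.symm))
  rw [h0, h1] at harc
  refine ⟨_, ?_, harc, le_antisymm ?_ (iInf₂_le _ harc)⟩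
  · rintro _ ⟨τ, -, rfl⟩
    exact ⟨_, rfl⟩
  · refine (hΦ.length_image_le hℓ hlip 0 |r|).trans (le_of_eq ?_)
    rw [hΦ, ← h0, ← h1, hfd' _ _ (hIcc _ ⟨le_rfl, abs_nonneg _⟩ _ ⟨abs_nonneg _, le_rfl⟩), zero_sub,
      sub_zero, abs_neg, abs_abs]

theorem Represents.half_le_dist (hΦ : Represents ℓ Φ) (e : G.edgeSet) {x y : X}
    (hx : Φ x = epoint e ⟨1 / 2, by norm_num, by norm_num⟩) (hy : Φ y = epoint e 0) :
    (ℓ e : ℝ) / 2 ≤ dist x y := by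
  have := hΦ.abs_sawtooth_sub_le e x y
  rw [hx, hy, sawtooth_epoint, sawtooth_epoint] at this
  norm_num at this
  linarith

/-- The midpoint of `e` has distance at least `ℓ e / 2` from an endvertex, while a circle of
circumference `b` has diameter at most `b / 2`. -/
theorem Represents.le_of_mem_edgesIn (hΦ : Represents ℓ Φ) {b : ℝ} (hb : 0 < b)
    {c : AddCircle b → X} (hc : Isometry c) {e : G.edgeSet}
    (he : e ∈ edgesIn (range fun p => Φ (c p))) : (ℓ e : ℝ) ≤ b := by
  rw [mem_edgesIn_iff] at he
  obtain ⟨p, hp⟩ := he ⟨1 / 2, by norm_num, by norm_num⟩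
  obtain ⟨q, hq⟩ := he 0
  have h1 := hΦ.half_le_dist e hp hq
  rw [hc.dist_eq, dist_eq_norm] at h1
  have h2 := AddCircle.norm_le_half_period b (x := p - q) hb.ne'
  rw [abs_of_pos hb] at h2
  linarith

end Representation

/-! ### Generation by geodetic circuits -/

section Generation

variable {V : Type u} {G : SimpleGraph V} {ℓ : G.edgeSet → ℝ≥0} {X : Type*} [MetricSpace X]
  {Φ : X ≃ₜ Space G}

/-- The `ℓ`-geodetic circuits all of whose edges have length at most `δ`. -/
def shortCircuits (G : SimpleGraph V) (ℓ : G.edgeSet → ℝ≥0) (δ : ℝ) : Set (Set G.edgeSet) :=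
  {D | D ∈ geodeticCircuits G ℓ ∧ ∀ e ∈ D, (ℓ e : ℝ) ≤ δ}

theorem continuous_sum_edgeCoord (F : Finset G.edgeSet) (Φ : X ≃ₜ Space G) :
    Continuous fun x => ∑ e ∈ F, edgeCoord e (Φ x) :=
  continuous_finsetSum _ fun e _ => (continuous_edgeCoord e).comp Φ.continuous

/-- If every short geodetic circuit meets `F` evenly, then so does every short loop. -/
theorem Represents.even_of_loop [CompactSpace X] (hΦ : Represents ℓ Φ) (hℓ : ∀ e, 0 < ℓ e)
    {F : Finset G.edgeSet} {δ : ℝ} (hF : ∀ D ∈ shortCircuits G ℓ δ, ∑ e ∈ F, ind D e = 0)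
    {x : X} {a : ℝ} {k : ℤ} (h : RPath (fun x => ∑ e ∈ F, edgeCoord e (Φ x)) x x a k)
    (ha : a ≤ δ) : Even k := by
  have := t2Space_of_homeomorph Φ
  by_contra hk
  rw [Int.not_even_iff_odd] at hk
  -- A loop of odd rise would yield an isometric circle of odd rise and circumference at most `δ`.
  -- Its circuit is short, and modulo 2 its rise counts its edges in `F`, contradicting `hF`.
  obtain ⟨b, hb, hba, c, hc, l, hl, hrise⟩ :=
    exists_isometric_circle hΦ.isLengthSpace (continuous_sum_edgeCoord F Φ) hk h
  have hcont : Continuous fun p => Φ (c p) := Φ.continuous.comp hc.continuous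
  have hcont' : ∀ e : G.edgeSet, Continuous fun t : ℝ => edgeCoord e (Φ (c t)) := fun e =>
    (continuous_edgeCoord e).comp' (hcont.comp (AddCircle.continuous_mk' b))
  choose n hn using fun e : G.edgeSet => exists_int_rise (hcont' e) (s := 0) (t := b)
    (by rw [AddCircle.coe_period, AddCircle.coe_zero])
  have hD := hF (edgesIn (range fun p => Φ (c p)))
    ⟨⟨_, hΦ.isGeodeticCircle hℓ hb hc, rfl⟩, fun e he => (hΦ.le_of_mem_edgesIn hb hc he).trans
      (hba.trans ha)⟩
  rw [Finset.sum_congr rfl fun e _ => ind_edgesIn_range hb hcont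
    (Φ.injective.comp hc.injective) e (hn e)] at hD
  rw [rise_sum F hcont'] at hrise
  simp only [hn] at hrise
  have h2 : ∑ e ∈ F, n e = l := by exact_mod_cast hrise
  have h3 := congrArg (Int.cast : ℤ → ZMod 2) h2
  push_cast at h3
  rw [hD, (ZMod.intCast_eq_one_iff_odd).2 hl] at h3
  exact zero_ne_one h3

open Classical in
theorem Represents.rPath_edge (hΦ : Represents ℓ Φ) (hℓ : ∀ e, 0 < ℓ e) (F : Finset G.edgeSet)
    (e : G.edgeSet) : RPath (fun x => ∑ e ∈ F, edgeCoord e (Φ x))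
      (Φ.symm (vertexPoint G (src e))) (Φ.symm (vertexPoint G (tgt e))) (ℓ e)
      ((if e ∈ F then 1 else 0 : ℤ) : ℝ) := by
  have hℓe : (0 : ℝ) < ℓ e := hℓ e
  have hlip := hΦ.lipschitzWith_edge_curve hℓ e
  refine ⟨hℓe.le, _, hlip, ?_, ?_, ?_⟩
  · simp only [zero_div, projIcc_left]
    exact congrArg _ (epoint_zero e)
  · simp only [div_self hℓe.ne', projIcc_right]
    exact congrArg _ (epoint_one e)
  · have hval : ∀ r : I, ∑ e' ∈ F, edgeCoord e' (epoint e r) =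
        ((if e ∈ F then (r : ℝ) else 0 : ℝ) : UnitAddCircle) := fun r => by
      split_ifs with h
      · rw [Finset.sum_eq_single_of_mem e h fun e' _ hne => edgeCoord_epoint_of_ne hne r,
          edgeCoord_epoint_self]
      · rw [Finset.sum_eq_zero fun e' he' => edgeCoord_epoint_of_ne (fun hee : e' = e => h (hee ▸ he')) r,
          AddCircle.coe_zero]
    rw [rise_eq (g := fun τ => if e ∈ F then τ / ℓ e else 0)
      ((continuous_sum_edgeCoord F Φ).comp' hlip.continuous)]
    · split_ifs <;> simp [hℓe.ne']
    · split_ifs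
      · exact (continuous_id.div_const _).continuousOn
      · exact continuousOn_const
    · intro τ hτ
      rw [uIcc_of_le hℓe.le] at hτ
      simp only [Homeomorph.apply_symm_apply]
      rw [hval, projIcc_of_mem zero_le_one ⟨div_nonneg hτ.1 hℓe.le, (div_le_one hℓe).2 hτ.2⟩]

/-- If every short geodetic circuit meets `F` evenly, then so does every `x` that is even on all
finite cuts and lives on the small components of `G - S`. -/
theorem Represents.sum_eq_zero [CompactSpace X] (hΦ : Represents ℓ Φ) (hℓ : ∀ e, 0 < ℓ e)
    {S : Finset V} (hS : (touching G S).Finite) {ε : ℝ}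
    (hsmall : ∀ v ∉ S, ∀ x ∈ compRegion G S v, ∀ y ∈ compRegion G S v,
      dist (Φ.symm x) (Φ.symm y) < ε)
    {F : Finset G.edgeSet} (hF : ∀ D ∈ shortCircuits G ℓ (4 * ε), ∑ e ∈ F, ind D e = 0)
    {x : G.edgeSet → ZMod 2} (hx : CutEven x) (hxS : ∀ e ∈ touching G S, x e = 0) :
    ∑ e ∈ F, x e = 0 := by
  classical
  set π : X → UnitAddCircle := fun x => ∑ e ∈ F, edgeCoord e (Φ x) with hπdef
  have hπ : Continuous π := continuous_sum_edgeCoord F Φ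
  have hπv : ∀ v, π (Φ.symm (vertexPoint G v)) = 0 := fun v => by
    simp only [hπdef, Homeomorph.apply_symm_apply, edgeCoord_vertexPoint, Finset.sum_const_zero]
  -- The classes are the components of `G - S`; equality is added because `JoinedOff` is not
  -- reflexive on `S`. Below, `rep` picks a root in each component.
  let R : Setoid V :=
    { r := fun u v => u = v ∨ JoinedOff G S u v
      iseqv := ⟨fun _ => Or.inl rfl, fun h => h.imp Eq.symm JoinedOff.symm, fun h h' => by
        rcases h with rfl | h
        · exact h'
        · rcases h' with rfl | h'
          · exact Or.inr h
          · exact Or.inr (h.trans h')⟩ }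
  let rep : V → V := fun v => (Quotient.mk R v).out
  have hrep : ∀ v ∉ S, JoinedOff G S (rep v) v := fun v hv => by
    rcases (Quotient.mk_out (s := R) v : R.r (rep v) v) with h | h
    · rw [show rep v = v from h]
      exact joinedOff_self hv
    · exact h
  have hrep' : ∀ u v, JoinedOff G S u v → rep u = rep v := fun u v h =>
    congrArg Quotient.out (Quotient.sound (s := R) (Or.inr h))
  have hex : ∀ v, ∃ k : ℤ, v ∉ S → ∃ a < ε, RPath π (Φ.symm (vertexPoint G (rep v)))
      (Φ.symm (vertexPoint G v)) a k := by
    intro v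
    by_cases hv : v ∈ S
    · exact ⟨0, fun h => absurd hv h⟩
    have hj := hrep v hv
    obtain ⟨a, ha, k, hk⟩ := hΦ.isLengthSpace.exists_rPath π
      (hsmall (rep v) hj.notMem_left _ (vertexPoint_mem_compRegion (joinedOff_self hj.notMem_left))
        _ (vertexPoint_mem_compRegion hj))
    obtain ⟨n, hn⟩ : ∃ n : ℤ, k = n := by
      obtain ⟨-, c, hc, h0, h1, rfl⟩ := hk
      exact exists_int_rise (hπ.comp' hc.continuous) (by simp only [h0, h1, hπv])
    exact ⟨n, fun _ => ⟨a, ha, hn ▸ hk⟩⟩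
  choose k hk using hex
  -- `k v` is the rise of `π` along a path shorter than `ε` from the root to `v`; it is an integer
  -- since `π` vanishes at vertices. An edge outside `S` changes its parity exactly when it belongs
  -- to `F`.
  set A : Set V := {v | v ∉ S ∧ Odd (k v)} with hA
  have hcut : ∀ e ∉ touching G S, e ∈ cutEdges G A ↔ e ∈ F := by
    intro e he
    rw [touching, mem_ofPred_eq, not_or] at he
    obtain ⟨a, ha, hp⟩ := hk _ he.1
    obtain ⟨a', ha', hp'⟩ := hk _ he.2
    have hjs := joinedOff_self (G := G) he.1
    have hjt := joinedOff_of_adj (adj_src_tgt e) he.1 he.2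
    rw [hrep' _ _ hjt] at hp
    -- Half of `e` fits into the component, so `ℓ e < 2 * ε`. The loop from the root through `e` and
    -- back has length less than `ε + 2 * ε + ε`, whence the bound `4 * ε` on the circuits.
    have hlen : (ℓ e : ℝ) / 2 < ε := by
      refine lt_of_le_of_lt (hΦ.half_le_dist e (Φ.apply_symm_apply _) (Φ.apply_symm_apply _)) ?_
      exact hsmall _ he.1 _ (epoint_mem_compRegion _ hjs hjt) _ (epoint_mem_compRegion _ hjs hjt)
    have hloop := (hp.trans hπ (hΦ.rPath_edge hℓ F e)).trans hπ (hp'.symm hπ)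
    have hev : Even (k (src e) + (if e ∈ F then 1 else 0) + -k (tgt e)) := by
      refine hΦ.even_of_loop hℓ hF (x := Φ.symm (vertexPoint G (rep (tgt e)))) (a := a + ℓ e + a')
        ?_ (by linarith)
      exact_mod_cast hloop
    rw [cutEdges, mem_ofPred_eq, hA, mem_ofPred_eq, mem_ofPred_eq]
    simp only [he.1, he.2, not_false_eq_true, true_and]
    split_ifs at hev with h
    · simp only [h, iff_true]
      rw [Int.even_add, even_neg, Int.even_add_one] at hev
      rw [← Int.not_even_iff_odd, ← Int.not_even_iff_odd]
      tauto
    · simp only [h, iff_false, not_not]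
      rw [Int.even_add, even_neg, add_zero] at hev
      rw [← Int.not_even_iff_odd, ← Int.not_even_iff_odd]
      tauto
  have hfin : (cutEdges G A).Finite := (F.finite_toSet.union hS).subset fun e he => by
    by_cases h : e ∈ touching G S
    · exact Or.inr h
    · exact Or.inl ((hcut e h).1 he)
  -- Only edges not touching `S` contribute, and among these `F` and the cut of `A` coincide.
  have hne : ∀ e, x e ≠ 0 → e ∉ touching G S := fun e h he => h (hxS e he)
  rw [← hx A hfin, ← Finset.sum_filter_of_ne (p := (· ∉ touching G S)) fun e _ => hne e,
    ← Finset.sum_filter_of_ne (s := hfin.toFinset) (p := (· ∉ touching G S)) fun e _ => hne e]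
  refine Finset.sum_congr ?_ fun _ _ => rfl
  ext e
  simp only [Finset.mem_filter, Finite.mem_toFinset]
  exact ⟨fun h => ⟨(hcut e h.2).2 h.1, h.2⟩, fun h => ⟨(hcut e h.2).1 h.1, h.2⟩⟩

/-- If every functional with finite support that vanishes on `𝒟` vanishes on `x`, then on every
finite set `x` agrees with a finite sum of members of `𝒟`. -/
theorem exists_list_of_functionals {E : Type*} {𝒟 : Set (Set E)} {x : E → ZMod 2}
    (h : ∀ F : Finset E, (∀ D ∈ 𝒟, ∑ e ∈ F, ind D e = 0) → ∑ e ∈ F, x e = 0) (F : Finset E) :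
    ∃ L : List (Set E), (∀ D ∈ L, D ∈ 𝒟) ∧ ∀ e ∈ F, x e = (L.map ind).sum e := by
  classical
  let res : (E → ZMod 2) → (F → ZMod 2) := fun y i => y i
  have hspan : ∀ y ∈ Submodule.span (ZMod 2) ((fun D => res (ind D)) '' 𝒟),
      ∃ L : List (Set E), (∀ D ∈ L, D ∈ 𝒟) ∧ y = res (L.map ind).sum := by
    intro y hy
    induction hy using Submodule.span_induction with
    | mem y hy =>
      obtain ⟨D, hD, rfl⟩ := hy
      exact ⟨[D], by simpa using hD, by simp⟩
    | zero => exact ⟨[], by simp, rfl⟩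
    | add y z _ _ hy hz =>
      obtain ⟨L, hL, rfl⟩ := hy
      obtain ⟨M, hM, rfl⟩ := hz
      refine ⟨L ++ M, fun D hD => (List.mem_append.1 hD).elim (hL D) (hM D), ?_⟩
      rw [List.map_append, List.sum_append]
      rfl
    | smul a y _ hy =>
      obtain ⟨L, hL, rfl⟩ := hy
      obtain rfl | rfl : a = 0 ∨ a = 1 := by
        revert a
        decide
      · exact ⟨[], by simp, by rw [zero_smul]; rfl⟩
      · exact ⟨L, hL, one_smul _ _⟩
  by_cases hx : res x ∈ Submodule.span (ZMod 2) ((fun D => res (ind D)) '' 𝒟)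
  · obtain ⟨L, hL, hxL⟩ := hspan _ hx
    exact ⟨L, hL, fun e he => congrFun hxL ⟨e, he⟩⟩
  -- If the restriction of `x` were not in the span, a linear functional would separate it. Over
  -- `ZMod 2` such a functional is summation over a subset of `F`, to which `h` applies.
  obtain ⟨f, hfx, hf⟩ := Submodule.exists_le_ker_of_notMem hx
  have hrepr : ∀ y : E → ZMod 2, f (res y) =
      ∑ e ∈ F.filter (fun e : E => f (fun i : F => if e = (i : E) then 1 else 0) = 1), y e := by
    intro y
    rw [f.pi_apply_eq_sum_univ, Finset.sum_filter, ← Finset.sum_coe_sort F]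
    refine Finset.sum_congr rfl fun i _ => ?_
    simp only [res, smul_eq_mul, Subtype.ext_iff]
    have hzo : ∀ a b : ZMod 2, b * a = if a = 1 then b else 0 := by decide
    exact hzo _ _
  refine absurd ?_ hfx
  rw [hrepr]
  refine h _ fun D hD => ?_
  rw [← hrepr]
  exact hf (Submodule.subset_span ⟨D, hD, rfl⟩)

theorem ind_injective {E : Type*} : Function.Injective (ind : Set E → E → ZMod 2) := by
  intro D D' h
  ext e
  have := congrFun h e
  simp only [ind] at this
  split_ifs at this with h1 h2 h2
  · exact iff_of_true h1 h2
  · exact absurd this one_ne_zero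
  · exact absurd this zero_ne_one
  · exact iff_of_false h1 h2

/-- Concatenating the lists chosen at all stages gives one indexed family; if an edge avoids all
stages from `J` on, its count modulo 2 is the finite sum of the first `J` stages. The lift places
the countable index type in the required universe. -/
theorem ind_thinSum_lists {E : Type*} (M : ℕ → List (Set E))
    {e : E} {J : ℕ} (hJ : ∀ j ≥ J, ∀ D ∈ M j, e ∉ D) :
    {i : ULift.{w} (Σ j, Fin (M j).length) | e ∈ (M i.down.1).get i.down.2}.Finite ∧
      ({i : ULift.{w} (Σ j, Fin (M j).length) | e ∈ (M i.down.1).get i.down.2}.ncard : ZMod 2) =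
        ∑ j ∈ Finset.range J, ((M j).map ind).sum e := by
  classical
  set T : Finset (Σ j, Fin (M j).length) := (Finset.range J).sigma
    fun j => Finset.univ.filter fun i => e ∈ (M j).get i with hT
  have hset : {i : ULift.{w} (Σ j, Fin (M j).length) | e ∈ (M i.down.1).get i.down.2} =
      ((T.map Equiv.ulift.symm.toEmbedding : Finset (ULift.{w} (Σ j, Fin (M j).length))) :
        Set (ULift.{w} (Σ j, Fin (M j).length))) := by
    ext ⟨j, i⟩
    rw [mem_ofPred_eq, Finset.mem_coe, Finset.mem_map_equiv, hT, Finset.mem_sigma]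
    refine ⟨fun h => ⟨Finset.mem_range.2 ?_, Finset.mem_filter.2 ⟨Finset.mem_univ _, h⟩⟩,
      fun h => (Finset.mem_filter.1 h.2).2⟩
    by_contra hj
    exact hJ j (not_lt.1 hj) _ (List.get_mem _ _) h
  refine ⟨by rw [hset]; exact Finset.finite_toSet _, ?_⟩
  rw [hset, ncard_coe_finset, Finset.card_map, hT, Finset.card_sigma, Nat.cast_sum]
  refine Finset.sum_congr rfl fun j _ => ?_
  rw [← Fin.sum_univ_fun_getElem, Finset.sum_apply]
  simp only [ind, List.get_eq_getElem, Finset.sum_ite, Finset.sum_const_zero, add_zero,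
    Finset.sum_const, nsmul_eq_mul, mul_one]

/-- Every set of edges that is even on all finite cuts is a thin sum of geodetic circuits. -/
theorem Represents.mem_thinSums [G.LocallyFinite] (hG : G.Connected) (hΦ : Represents ℓ Φ)
    (hℓ : ∀ e, 0 < ℓ e) {D : Set G.edgeSet} (hD : CutEven (ind D)) :
    D ∈ thinSums.{u, w} (geodeticCircuits G ℓ) := by
  classical
  have := t2Space_of_homeomorph Φ
  have := compactSpace hG
  have : CompactSpace X := Φ.symm.compactSpace
  obtain ⟨o⟩ := hG.nonempty
  obtain ⟨C, hC⟩ := Metric.isBounded_iff.1 (isCompact_univ (X := X)).isBounded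
  have hN : ∀ j : ℕ, ∃ n, ∀ m ≥ n, ∀ v ∉ gball hG o m, ∀ x ∈ compRegion G (gball hG o m) v,
      ∀ y ∈ compRegion G (gball hG o m) v, dist (Φ.symm x) (Φ.symm y) < 1 / ((j : ℝ) + 1) :=
    fun j => exists_gball_small hG o (d := fun x y => dist (Φ.symm x) (Φ.symm y))
      (fun x y z => dist_triangle_left _ _ _)
      (fun x r hr => by
        filter_upwards [Φ.symm.continuous.continuousAt.preimage_mem_nhds
          (Metric.ball_mem_nhds (Φ.symm x) hr)] with y hy
        rw [dist_comm]
        exact hy) (by positivity)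
  choose N hN using hN
  -- At stage `0` nothing has been removed and no edge touches `∅`; the constant `C + 1` exceeds the
  -- diameter of the whole space. At later stages `N j` makes the components small, and the maximum
  -- with `j` makes the balls exhaust `V`.
  let S : ℕ → Finset V := fun j => Nat.casesOn j ∅ fun j => gball hG o (max (N j) j)
  let ε : ℕ → ℝ := fun j => Nat.casesOn j (C + 1) fun j => 1 / ((j : ℝ) + 1)
  have hsmall : ∀ j, ∀ v ∉ S j, ∀ x ∈ compRegion G (S j) v, ∀ y ∈ compRegion G (S j) v,
      dist (Φ.symm x) (Φ.symm y) < ε j := by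
    intro j v hv x hx y hy
    cases j with
    | zero => exact lt_of_le_of_lt (hC (mem_univ _) (mem_univ _)) (lt_add_one C)
    | succ j => exact hN j _ (le_max_left _ _) v hv x hx y hy
  -- Stated for arbitrary `y`, with the empty list as a dummy value, so that the lists can be chosen
  -- before the recursion defining the remainders `x j`.
  have hstep : ∀ (j : ℕ) (y : G.edgeSet → ZMod 2), ∃ L : List (Set G.edgeSet),
      CutEven y ∧ (∀ e ∈ touching G (S j), y e = 0) →
        (∀ D ∈ L, D ∈ shortCircuits G ℓ (4 * ε j)) ∧
          ∀ e ∈ touching G (S (j + 1)), y e = (L.map ind).sum e := by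
    intro j y
    by_cases hy : CutEven y ∧ ∀ e ∈ touching G (S j), y e = 0
    · obtain ⟨L, hL, hL'⟩ := exists_list_of_functionals (𝒟 := shortCircuits G ℓ (4 * ε j))
        (fun F hF => hΦ.sum_eq_zero hℓ (finite_touching (S j)) (hsmall j) hF hy.1 hy.2)
        (finite_touching (S (j + 1))).toFinset
      exact ⟨L, fun _ => ⟨hL, fun e he => hL' e ((finite_touching _).mem_toFinset.2 he)⟩⟩
    · exact ⟨[], fun h => absurd h hy⟩
  choose L hL using hstep
  let x : ℕ → G.edgeSet → ZMod 2 := fun j =>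
    Nat.rec (ind D) (fun j y => y + ((L j y).map ind).sum) j
  have hxsucc : ∀ j, x (j + 1) = x j + ((L j (x j)).map ind).sum := fun j => rfl
  have hx : ∀ j, CutEven (x j) ∧ ∀ e ∈ touching G (S j), x j e = 0 := by
    intro j
    induction j with
    | zero =>
      refine ⟨hD, fun e he => ?_⟩
      rcases he with he | he <;> exact absurd he (Finset.notMem_empty _)
    | succ j ih =>
      obtain ⟨h1, h2⟩ := hL j (x j) ih
      rw [hxsucc]
      refine ⟨ih.1.add (CutEven.listSum fun y hy => ?_), fun e he => ?_⟩
      · obtain ⟨D', hD', rfl⟩ := List.mem_map.1 hy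
        obtain ⟨⟨C', hC', rfl⟩, -⟩ := h1 D' hD'
        exact CutEven.circle hC'.1
      · rw [Pi.add_apply, ← h2 e he, CharTwo.add_self_eq_zero]
  have hxsum : ∀ J, x J = ind D + ∑ j ∈ Finset.range J, ((L j (x j)).map ind).sum := by
    intro J
    induction J with
    | zero => simp [x]
    | succ J ih => rw [hxsucc, Finset.sum_range_succ, ← add_assoc, ← ih]
  have hlim : ∀ e : G.edgeSet, ∃ J, x J e = 0 ∧ ∀ j ≥ J, ∀ D ∈ L j (x j), e ∉ D := by
    intro e
    have hℓe : (0 : ℝ) < ℓ e := hℓ e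
    obtain ⟨n, hn⟩ := exists_nat_gt (4 / (ℓ e : ℝ))
    -- From this stage on the ball contains `src e`, so the remainder vanishes at `e`; and since `j
    -- ≥ n > 4 / ℓ e` after the index shift, the admitted edge length `4 / (j + 1)` is below `ℓ e`,
    -- so no later circuit contains `e`.
    refine ⟨max n (G.dist o (src e)) + 1,
      (hx (max n (G.dist o (src e)) + 1)).2 e (Or.inl ?_), fun j hj D' hD' heD => ?_⟩
    · exact mem_gball.2 ((le_max_right _ _).trans (le_max_right _ _))
    · have h := ((hL j (x j) (hx j)).1 D' hD').2 e heD
      obtain ⟨j, rfl⟩ : ∃ i, j = i + 1 := ⟨j - 1, by omega⟩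
      change (ℓ e : ℝ) ≤ 4 * (1 / ((j : ℝ) + 1)) at h
      have hjn : (n : ℝ) ≤ j := by
        have := le_max_left n (G.dist o (src e))
        exact_mod_cast (by omega : n ≤ j)
      rw [div_lt_iff₀ hℓe] at hn
      rw [mul_one_div, le_div_iff₀ (by positivity)] at h
      nlinarith
  set M : ℕ → List (Set G.edgeSet) := fun j => L j (x j) with hM
  refine ⟨ULift.{w} (Σ j, Fin (M j).length), fun i => (M i.down.1).get i.down.2, fun i => ?_,
    fun e => ?_, ?_⟩
  · exact ((hL _ _ (hx i.down.1)).1 _ (List.get_mem _ _)).1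
  · obtain ⟨J, -, hJ⟩ := hlim e
    exact (ind_thinSum_lists M hJ).1
  · refine ind_injective (funext fun e => ?_)
    obtain ⟨J, hJ0, hJ⟩ := hlim e
    rw [ind_thinSum, (ind_thinSum_lists M hJ).2]
    rw [hxsum, Pi.add_apply, Finset.sum_apply] at hJ0
    rw [CharTwo.add_eq_zero.1 hJ0]

end Generation

end EndGraph

/-! ### The generation theorem -/

theorem theorem1p2 {V : Type u} (G : SimpleGraph V) [G.LocallyFinite]
    (hG : G.Connected) (ℓ : G.edgeSet → NNReal)
    (hℓ : EndGraph.IsMetricRepresentation G ℓ) :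
    EndGraph.cycleSpace.{u, w} G =
      EndGraph.thinSums.{u, w} (EndGraph.geodeticCircuits G ℓ) := by
  obtain ⟨hpos, m, hd, htop⟩ := hℓ
  -- The identity map, from the metric topology to the topology of `|G|`. Treating the metric space
  -- as a separate copy keeps the two topologies, which agree only propositionally, apart.
  let Φ : @Homeomorph (EndGraph.Space G) (EndGraph.Space G)
      m.toUniformSpace.toTopologicalSpace (EndGraph.Space.instTopologicalSpace G) :=
    @Homeomorph.mk _ _ m.toUniformSpace.toTopologicalSpace (EndGraph.Space.instTopologicalSpace G)
      (Equiv.refl _) (continuous_id_iff_le.2 htop.le) (continuous_id_iff_le.2 htop.ge)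
  have hΦ : @EndGraph.Represents V G (EndGraph.Space G) m ℓ Φ := hd
  apply Subset.antisymm
  · rintro D ⟨ι, F, hF, hthin, rfl⟩
    refine @EndGraph.Represents.mem_thinSums V G ℓ (EndGraph.Space G) m Φ _ hG hΦ hpos _
      (EndGraph.CutEven.thinSum hthin fun i => ?_)
    obtain ⟨C, hC, h⟩ := hF i
    rw [h]
    have : T2Space (EndGraph.Space G) :=
      @EndGraph.t2Space_of_homeomorph V G (EndGraph.Space G) m Φ
    exact EndGraph.CutEven.circle hC
  · rintro D ⟨ι, F, hF, hthin, rfl⟩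
    refine ⟨ι, F, fun i => ?_, hthin, rfl⟩
    obtain ⟨C, hC, h⟩ := hF i
    exact ⟨C, hC.1, h⟩
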